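/- Write $\mu$ for the Möbius function, $\tau$ for the number-of-divisors function, $\left(\frac{\cdot}{\cdot}\right)$ for the Jacobi symbol, and $L(s,\chi)$ for the $L$-function of a Dirichlet character $\chi$. (1) There is an absolute constant $K$ such that for all real $X\ge 3$ $$\left|\sum_{1<m\le X}\frac{\mu^2(2m)}{\tau(m)}\,L\!\left(1,\left(\tfrac{\cdot}{m}\right)\right)\right|\le K\,\frac{X}{\sqrt{\log X}} .$$ (2) More generally, for every integer $q\ge 1$ and every real $C$ there is a constant $K=K(q,C)$ with the following property. Let $\chi$ be a Dirichlet character modulo $q$, let $0<\alpha\le 1$, and let $f$ be a real-valued multiplicative function such that $0\le f(p)\le 1$ and $f(p^k)\le f(p)$ for all primes $p$ and all $k\ge 2$, and such that $$\left|\sum_{p\le Y}\frac{f(p)}{p}-\alpha\log\log Y\right|\le C\qquad\text{for all real } Y\ge 2 .$$ Then for all real $X\ge 3$ and all odd integers $1\le m_1\le X$, $$\left|\sum_{\substack{1<m\le X\\ \gcd(mm_1,q)=1}}\mu^2(2mm_1)\,f(m)\,L(1,\chi\cdot\psi_{mm_1})\right|\le K\,\frac{X}{(\log X)^{1-\alpha}}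 ,$$ where, for odd $k\geq 1$, $\psi_k$ denotes either the character $n\mapsto\left(\frac{n}{k}\right)$ modulo $k$ (for every $k$) or the character modulo $4k$ given by $n\mapsto\left(\frac{k}{n}\right)$ for odd $n$ and by $0$ for even $n$ (for every $k$); the bound holds for both choices. Here $\chi\cdot\psi_k$ is the pointwise product $n\mapsto\chi(n)\psi_k(n)$. -/

import Mathlib

/-- The Jacobi symbol `n ↦ (n / m)` as a Dirichlet character modulo `m`
(see `jacobiTop_natCast`: its value at `n` is the Jacobi symbol). -/
noncomputable def jacobiTop (m : ℕ) : DirichletCharacter ℂ m where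
  toFun a := open Classical in if IsUnit a then ((jacobiSym (a.val : ℤ) m : ℤ) : ℂ) else 0
  map_one' := by
    rw [if_pos isUnit_one]
    rcases Nat.lt_trichotomy m 1 with h | h | h
    · obtain rfl : m = 0 := by omega
      simp
    · subst h
      simp
    · have : Fact (1 < m) := ⟨h⟩
      simp [ZMod.val_one]
  map_mul' a b := by
    by_cases ha : IsUnit a
    · by_cases hb : IsUnit b
      · rw [if_pos (ha.mul hb), if_pos ha, if_pos hb, ZMod.val_mul, Int.natCast_mod,
          ← jacobiSym.mod_left, Nat.cast_mul, jacobiSym.mul_left]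
        push_cast
        rfl
      · rw [if_neg (fun h => hb (isUnit_of_mul_isUnit_right h)), if_neg hb, mul_zero]
    · rw [if_neg (fun h => ha (isUnit_of_mul_isUnit_left h)), if_neg ha, zero_mul]
  map_nonunit' a ha := if_neg ha

theorem jacobiTop_natCast {m : ℕ} (hm : m ≠ 0) (n : ℕ) :
    jacobiTop m (n : ZMod m) = ((jacobiSym (n : ℤ) m : ℤ) : ℂ) := by
  have : NeZero m := ⟨hm⟩
  by_cases h : IsUnit (n : ZMod m)
  · have e : jacobiTop m (n : ZMod m) =
        ((jacobiSym (((n : ZMod m).val : ℕ) : ℤ) m : ℤ) : ℂ) := if_pos h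
    rw [e, ZMod.val_natCast, Int.natCast_mod, ← jacobiSym.mod_left]
  · rw [MulChar.map_nonunit _ h]
    rw [ZMod.isUnit_iff_coprime] at h
    rw [jacobiSym.eq_zero_iff_not_coprime.mpr]
    · simp
    · simpa [Int.gcd_natCast_natCast] using h

theorem odd_val_of_isUnit_zmod_four_mul {m : ℕ} {a : ZMod (4 * m)} (ha : IsUnit a) :
    Odd a.val := by
  have h1 : Nat.Coprime a.val (4 * m) := by
    obtain ⟨u, rfl⟩ := ha
    exact ZMod.val_coe_unit_coprime u
  have h2 : Nat.Coprime a.val 2 := h1.coprime_dvd_right ⟨2 * m, by ring⟩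
  exact (Nat.coprime_two_right).mp h2

/-- The Jacobi symbol `n ↦ (m / n)`, defined for odd `n` and extended by `0` to even `n`, as a
Dirichlet character modulo `4 m` (see `jacobiBottom_natCast`). -/
noncomputable def jacobiBottom (m : ℕ) : DirichletCharacter ℂ (4 * m) where
  toFun a := open Classical in if IsUnit a then ((jacobiSym (m : ℤ) a.val : ℤ) : ℂ) else 0
  map_one' := by
    rw [if_pos isUnit_one]
    rcases Nat.eq_zero_or_pos m with h | h
    · subst h
      change ((jacobiSym ((0 : ℕ) : ℤ) (Int.natAbs 1) : ℤ) : ℂ) = 1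
      simp
    · have : Fact (1 < 4 * m) := ⟨by omega⟩
      simp [ZMod.val_one]
  map_mul' a b := by
    by_cases ha : IsUnit a
    · by_cases hb : IsUnit b
      · have h1 := odd_val_of_isUnit_zmod_four_mul ha
        have h2 := odd_val_of_isUnit_zmod_four_mul hb
        have h3 := jacobiSym.mod_right (m : ℤ) (h1.mul h2)
        rw [Int.natAbs_natCast] at h3
        have : NeZero a.val := ⟨h1.pos.ne'⟩
        have : NeZero b.val := ⟨h2.pos.ne'⟩
        rw [if_pos (ha.mul hb), if_pos ha, if_pos hb, ZMod.val_mul, ← h3, jacobiSym.mul_right]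
        push_cast
        rfl
      · rw [if_neg (fun h => hb (isUnit_of_mul_isUnit_right h)), if_neg hb, mul_zero]
    · rw [if_neg (fun h => ha (isUnit_of_mul_isUnit_left h)), if_neg ha, zero_mul]
  map_nonunit' a ha := if_neg ha

theorem jacobiBottom_natCast {m : ℕ} (hm : m ≠ 0) (n : ℕ) :
    jacobiBottom m (n : ZMod (4 * m)) =
      if Odd n then ((jacobiSym (m : ℤ) n : ℤ) : ℂ) else 0 := by
  have : NeZero (4 * m) := ⟨by omega⟩
  by_cases h : IsUnit (n : ZMod (4 * m))
  · have hc := (ZMod.isUnit_iff_coprime n (4 * m)).mp h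
    have ho : Odd n := Nat.coprime_two_right.mp (hc.coprime_dvd_right ⟨2 * m, by ring⟩)
    have h3 := jacobiSym.mod_right (m : ℤ) ho
    rw [Int.natAbs_natCast] at h3
    have e : jacobiBottom m (n : ZMod (4 * m)) =
        ((jacobiSym (m : ℤ) (n : ZMod (4 * m)).val : ℤ) : ℂ) := if_pos h
    rw [e, if_pos ho, ZMod.val_natCast, ← h3]
  · rw [MulChar.map_nonunit _ h]
    split_ifs with ho
    · rw [ZMod.isUnit_iff_coprime] at h
      have : NeZero n := ⟨ho.pos.ne'⟩
      rw [jacobiSym.eq_zero_iff_not_coprime.mpr]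
      · simp
      · rw [Int.gcd_natCast_natCast]
        intro hc
        apply h
        have h4 : Nat.Coprime n (2 ^ 2) := (Nat.coprime_two_right.mpr ho).pow_right 2
        exact Nat.Coprime.mul_right h4 (Nat.Coprime.symm hc)
    · rfl

/-- The product `n ↦ χ(n) ψ(n)` of Dirichlet characters modulo `q` and `N`, as a character modulo
`q N` (it is not replaced by the primitive character that induces it). -/
noncomputable def charProd {q N : ℕ} (χ : DirichletCharacter ℂ q) (ψ : DirichletCharacter ℂ N) :
    DirichletCharacter ℂ (q * N) :=
  DirichletCharacter.changeLevel (Nat.dvd_mul_right q N) χ *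
    DirichletCharacter.changeLevel (Nat.dvd_mul_left N q) ψ

theorem charProd_natCast {q N : ℕ} (χ : DirichletCharacter ℂ q) (ψ : DirichletCharacter ℂ N)
    (n : ℕ) : charProd χ ψ (n : ZMod (q * N)) = χ (n : ZMod q) * ψ (n : ZMod N) := by
  by_cases h : IsUnit (n : ZMod (q * N))
  · have e1 := DirichletCharacter.changeLevel_eq_cast_of_dvd χ (Nat.dvd_mul_right q N) h.unit
    have e2 := DirichletCharacter.changeLevel_eq_cast_of_dvd ψ (Nat.dvd_mul_left N q) h.unit
    rw [IsUnit.unit_spec, ZMod.cast_natCast (Nat.dvd_mul_right q N)] at e1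
    rw [IsUnit.unit_spec, ZMod.cast_natCast (Nat.dvd_mul_left N q)] at e2
    rw [charProd, MulChar.mul_apply, e1, e2]
  · rw [MulChar.map_nonunit _ h]
    rw [ZMod.isUnit_iff_coprime, Nat.coprime_mul_iff_right, not_and_or] at h
    rcases h with h | h
    · rw [MulChar.map_nonunit χ (by rwa [ZMod.isUnit_iff_coprime]), zero_mul]
    · rw [MulChar.map_nonunit ψ (by rwa [ZMod.isUnit_iff_coprime]), mul_zero]

/-- The value `L(1, χ)` of the Dirichlet `L`-function of a Dirichlet character `χ` modulo `N ≥ 1`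
(the case `N = 0` is a placeholder). -/
noncomputable def LOne {N : ℕ} (χ : DirichletCharacter ℂ N) : ℂ :=
  if h : N = 0 then 0
  else
    haveI : NeZero N := ⟨h⟩
    DirichletCharacter.LFunction χ 1

/-- `f` is multiplicative with `0 ≤ f(p) ≤ 1` and `f(p^k) ≤ f(p)` for all primes `p` and `k ≥ 2`,
and `∑_{p ≤ X} f(p) / p = α log log X + O(1)` for all `X ≥ 2`, with `O(1)` bounded by `C`. -/
structure HasMertensDensity (f : ArithmeticFunction ℝ) (α C : ℝ) : Prop where
  multiplicative : f.IsMultiplicative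
  nonneg : ∀ p : ℕ, p.Prime → 0 ≤ f p
  le_one : ∀ p : ℕ, p.Prime → f p ≤ 1
  pow_le : ∀ p : ℕ, p.Prime → ∀ k : ℕ, 2 ≤ k → f (p ^ k) ≤ f p
  mertens : ∀ X : ℝ, 2 ≤ X →
    |∑ p ∈ (Finset.Icc 1 ⌊X⌋₊).filter Nat.Prime, f p / (p : ℝ)
      - α * Real.log (Real.log X)| ≤ C

/-! Cancellation between different `m` plays no role. With N = ⌊X⌋, it is shown that ∑ f(m)|L(1, ·)|
over odd squarefree m ≤ N satisfies the bound N / log N · exp(∑_{p ≤ N} f(p)/p) that is familiar for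
∑ f(m) alone; the Mertens-type hypothesis (or f(p) = 1/2 when f = 1/τ) turns this into X / (log
X)^(1-α). The character χ and the fixed factor m₁ are absorbed into coefficients a(n) with |a(n)| ≤
1, so everything rests on partial sums ∑ a(n)(n/m)/n. Quadratic reciprocity reduces the symbol (k/n)
to (n/k), up to a twist depending on n mod 4. The series for L(1, ·) is cut at y ≈ N^(1/12) and at
N².

Initial segment n ≤ y. Put each prime p ≤ y into a random set Q with probability 1 - f(p); then f(m)
is at most the probability that no prime of Q divides m. For fixed Q, the indicator of that event is
majorized by the square of the Selberg form, and the second moment of the segment against this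
square is computed by opening both squares. Pairs with n₁n₂ a square give at most 8 times the sieve
bound, since ∑ 1/(n₁n₂) over them converges; the other pairs give a nontrivial character in m, with
bounded sums. Averaging the sieve bound over Q produces ∏ (1 + f(p)/(p-1))
(`sum_multiplicative_mul_norm_sq_le`).

Segment y < n ≤ N². Its 36th power is a Dirichlet polynomial over n ≥ (y+1)^36 > N³. Cauchy–Schwarz
and the oscillation of n ↦ (n/mm') for m ≠ m' bound the 36th moment over m by √N times powers of log
N, so the segment is at most 1/log N on average (`sum_norm_jacobiSum₁_tail_le`).

Range n > N². The modulus is at most 4qN², so Abel summation leaves a bounded error for each m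
(`norm_LOne_sub_sum_le`), and ∑ f(m) is itself covered by the sieve estimate. -/

/-- The Jacobi symbol `(n / m)` as a real number, extended by `0` to even `m`. -/
noncomputable def oddJacobi (n m : ℕ) : ℝ := if Odd m then ((jacobiSym (n : ℤ) m : ℤ) : ℝ) else 0

theorem oddJacobi_mul_left (a b m : ℕ) :
    oddJacobi (a * b) m = oddJacobi a m * oddJacobi b m := by
  unfold oddJacobi
  split_ifs
  · push_cast [jacobiSym.mul_left]; rfl
  · simp

theorem oddJacobi_mul_right (n a b : ℕ) :
    oddJacobi n (a * b) = oddJacobi n a * oddJacobi n b := by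
  unfold oddJacobi
  by_cases ha : Odd a
  · by_cases hb : Odd b
    · rw [if_pos ha, if_pos hb, if_pos (ha.mul hb), jacobiSym.mul_right' _ ha.pos.ne' hb.pos.ne']
      push_cast; rfl
    · simp [hb, Nat.odd_mul]
  · simp [ha, Nat.odd_mul]

theorem abs_oddJacobi_le (n m : ℕ) : |oddJacobi n m| ≤ 1 := by
  unfold oddJacobi
  split_ifs
  · rcases jacobiSym.trichotomy (n : ℤ) m with h | h | h <;> simp [h]
  · simp

theorem oddJacobi_one_left (m : ℕ) (hm : Odd m) : oddJacobi 1 m = 1 := by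
  simp [oddJacobi, hm]

/-! ### Nontriviality of Jacobi characters and bounds for their incomplete sums. -/

theorem sum_Ico_period_eq_zero {N : ℕ} [NeZero N] {χ : DirichletCharacter ℂ N} (hχ : χ ≠ 1)
    (A : ℕ) : ∑ n ∈ Finset.Ico A (A + N), χ (n : ZMod N) = 0 := by
  rw [← MulChar.sum_eq_zero_of_ne_one hχ]
  refine Finset.sum_nbij (fun n => (n : ZMod N)) (fun _ _ => Finset.mem_univ _) ?_ ?_
    (fun _ _ => rfl)
  · intro a ha b hb hab
    simp only [Finset.coe_Ico, Set.mem_Ico] at ha hb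
    have h := (ZMod.natCast_eq_natCast_iff a b N).mp hab
    rcases le_total a b with h' | h'
    · exact Nat.ModEq.eq_of_abs_lt h (by rw [abs_lt]; omega)
    · exact Nat.ModEq.eq_of_abs_lt h (by rw [abs_lt]; omega)
  · intro a _
    have h : a.val ∈ (Finset.Ico A (A + N)).image (· % N) := by
      rw [Nat.image_Ico_mod]
      exact Finset.mem_range.mpr a.val_lt
    obtain ⟨n, hn, hna⟩ := Finset.mem_image.mp h
    refine ⟨n, by simpa using hn, ?_⟩
    have : ((n % N : ℕ) : ZMod N) = ((a.val : ℕ) : ZMod N) := by rw [hna]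
    simpa using this

/-- Full periods cancel, and fewer than `N` terms remain; no Pólya–Vinogradov saving is needed. -/
theorem norm_sum_Ioc_le_of_ne_one {N : ℕ} [NeZero N] {χ : DirichletCharacter ℂ N} (hχ : χ ≠ 1)
    (A B : ℕ) : ‖∑ n ∈ Finset.Ioc A B, χ (n : ZMod N)‖ ≤ N := by
  have key : ∀ k A : ℕ, ‖∑ n ∈ Finset.Ico A (A + k), χ (n : ZMod N)‖ ≤ N := by
    intro k
    induction k using Nat.strong_induction_on with
    | _ k ih =>
      intro A
      by_cases hk : k < N
      · calc ‖∑ n ∈ Finset.Ico A (A + k), χ (n : ZMod N)‖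
            ≤ ∑ n ∈ Finset.Ico A (A + k), (1 : ℝ) :=
              norm_sum_le_of_le _ fun n _ => DirichletCharacter.norm_le_one χ _
          _ = k := by simp
          _ ≤ N := by exact_mod_cast hk.le
      · push Not at hk
        have hN : 0 < N := Nat.pos_of_ne_zero (NeZero.ne N)
        rw [← Finset.sum_Ico_consecutive _ (by omega : A ≤ A + N) (by omega : A + N ≤ A + k),
          sum_Ico_period_eq_zero hχ, zero_add]
        have := ih (k - N) (by omega) (A + N)
        rwa [show A + N + (k - N) = A + k by omega] at this
  rcases le_total A B with h | h
  · have := key (B - A) (A + 1)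
    have e : Finset.Ioc A B = Finset.Ico (A + 1) (A + 1 + (B - A)) := by
      ext x; simp only [Finset.mem_Ioc, Finset.mem_Ico]; omega
    rwa [e]
  · rw [Finset.Ioc_eq_empty (by omega)]; simp

theorem DirichletCharacter.ne_one_of_apply_natCast {N : ℕ} {χ : DirichletCharacter ℂ N} {n : ℕ}
    (h : χ (n : ZMod N) = -1) : χ ≠ 1 := by
  rintro rfl
  by_cases hu : IsUnit (n : ZMod N)
  · rw [MulChar.one_apply hu] at h; norm_num at h
  · rw [MulChar.map_nonunit _ hu] at h; norm_num at h

theorem exists_jacobiSym_prime_eq_neg_one {p : ℕ} (hp : p.Prime) (hp2 : p ≠ 2) :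
    ∃ r : ℕ, jacobiSym (r : ℤ) p = -1 := by
  have : Fact p.Prime := ⟨hp⟩
  obtain ⟨a, ha⟩ := FiniteField.exists_nonsquare (F := ZMod p) (by rwa [ZMod.ringChar_zmod_n])
  refine ⟨a.val, ?_⟩
  rw [← jacobiSym.legendreSym.to_jacobiSym, legendreSym.eq_neg_one_iff]
  simpa using ha

/-- A nonsquare `k` has a prime factor `p` of odd exponent. By the Chinese remainder theorem `n` can
be a nonresidue modulo `p` and 1 modulo everything else. The condition `n ≡ 1` modulo `q` keeps the
symbol nontrivial after multiplication by any character modulo `q`. -/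
theorem exists_modEq_one_jacobiSym_eq_neg_one {k q : ℕ} (hk : Odd k) (hsq : ¬ IsSquare k)
    (hq : q.Coprime k) : ∃ n : ℕ, n ≡ 1 [MOD q] ∧ jacobiSym (n : ℤ) k = -1 := by
  obtain ⟨a, b, hab, ha⟩ := Nat.sq_mul_squarefree k
  have ha1 : a ≠ 1 := by
    rintro rfl
    exact hsq ⟨b, by rw [← hab]; ring⟩
  obtain ⟨p, hp, a', rfl⟩ := Nat.exists_prime_and_dvd ha1
  have hpa : p.Coprime a' := Nat.coprime_of_squarefree_mul ha
  have hk0 : k ≠ 0 := hk.pos.ne'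
  have hb0 : b ≠ 0 := by rintro rfl; simp at hab; omega
  have ha0 : a' ≠ 0 := by rintro rfl; simp at hab; omega
  obtain ⟨v, c, hpc, rfl⟩ := Nat.exists_eq_pow_mul_and_not_dvd hb0 p hp.ne_one
  have hc0 : c ≠ 0 := by rintro rfl; simp at hpc
  have hpk : p ∣ k := ⟨(p ^ v * c) ^ 2 * a', by rw [← hab]; ring⟩
  have hp2 : p ≠ 2 := by
    rintro rfl
    exact (Nat.not_even_iff_odd.mpr hk) (even_iff_two_dvd.mpr hpk)
  obtain ⟨r, hr⟩ := exists_jacobiSym_prime_eq_neg_one hp hp2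
  have hcop : p.Coprime (q * (a' * c)) := by
    refine Nat.Coprime.mul_right ?_ (Nat.Coprime.mul_right hpa ((Nat.Prime.coprime_iff_not_dvd hp).mpr hpc))
    exact (hq.coprime_dvd_right hpk).symm
  obtain ⟨n, hn1, hn2⟩ := Nat.chineseRemainder hcop r 1
  refine ⟨n, hn2.of_mul_right _, ?_⟩
  have hp0 := hp.ne_zero
  have e1 : jacobiSym (n : ℤ) p = -1 := by
    rw [← hr]
    exact jacobiSym.mod_left' (by exact_mod_cast hn1)
  have h1 : ∀ d, d ∣ q * (a' * c) → jacobiSym (n : ℤ) d = 1 := by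
    intro d hd
    rw [← jacobiSym.one_left d]
    exact jacobiSym.mod_left' (by exact_mod_cast hn2.of_dvd hd)
  -- The exponent of `p` in `k` is 2v + 1, so the factor -1 survives, while `c` and `a'` contribute
  -- 1.
  rw [← hab, show (p ^ v * c) ^ 2 * (p * a') = p ^ (2 * v + 1) * (c ^ 2 * a') by ring,
    jacobiSym.mul_right' _ (by positivity) (by positivity),
    jacobiSym.mul_right' _ (by positivity) (by positivity), jacobiSym.pow_right,
    jacobiSym.pow_right, e1, h1 c ⟨q * a', by ring⟩, h1 a' ⟨q * c, by ring⟩]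
  rw [pow_succ, pow_mul]
  norm_num

/-- Write n = 2^a k with `k` odd. If `a` is even, `k` is a nonsquare and reciprocity with m ≡ 1 mod
4 reduces to the previous existence result. If `a` is odd, m ≡ 5 mod 8 and m ≡ 1 mod k give (2/m) =
-1 and (k/m) = 1. -/
theorem exists_odd_jacobiSym_eq_neg_one {n : ℕ} (hn : n ≠ 0) (hsq : ¬ IsSquare n) :
    ∃ m : ℕ, Odd m ∧ jacobiSym (n : ℤ) m = -1 := by
  obtain ⟨a, k, hk, rfl⟩ := Nat.exists_eq_two_pow_mul_odd hn
  rcases Nat.even_or_odd a with ha | ha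
  · have hk' : ¬ IsSquare k := by
      intro h
      exact hsq ((ha.isSquare_pow 2).mul h)
    have hc : Nat.Coprime 4 k := by
      have := (Nat.coprime_two_left.mpr hk).pow_left 2
      simpa using this
    obtain ⟨m, hm4, hm⟩ := exists_modEq_one_jacobiSym_eq_neg_one hk hk' hc
    have hm4' : m % 4 = 1 := hm4
    have hmo : Odd m := Nat.odd_iff.mpr (by omega)
    refine ⟨m, hmo, ?_⟩
    obtain ⟨b, rfl⟩ := ha
    push_cast
    rw [jacobiSym.mul_left, jacobiSym.pow_left, ← two_mul, pow_mul, jacobiSym.sq_one, one_pow,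
      jacobiSym.quadratic_reciprocity_one_mod_four' hk hm4', hm, one_mul]
    have := Nat.coprime_two_left.mpr hmo
    exact_mod_cast this
  · have hc : Nat.Coprime 8 k := by
      have := (Nat.coprime_two_left.mpr hk).pow_left 3
      simpa using this
    obtain ⟨m, hm1, hm2⟩ := Nat.chineseRemainder hc 5 1
    have hm8 : m % 8 = 5 := hm1
    have hmo : Odd m := Nat.odd_iff.mpr (by omega)
    refine ⟨m, hmo, ?_⟩
    push_cast
    rw [jacobiSym.mul_left, jacobiSym.pow_left,
      jacobiSym.quadratic_reciprocity_one_mod_four' hk (by omega), jacobiSym.at_two hmo]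
    have e1 : jacobiSym (m : ℤ) k = 1 := by
      rw [← jacobiSym.one_left k]
      exact jacobiSym.mod_left' (by exact_mod_cast hm2)
    have e2 : ZMod.χ₈ (m : ZMod 8) = -1 := by
      rw [ZMod.χ₈_nat_mod_eight, hm8]; rfl
    rw [e1, e2, ha.neg_one_pow]; norm_num

theorem abs_sum_oddJacobi_right_le {n : ℕ} (hn : n ≠ 0) (hsq : ¬ IsSquare n) (M : ℕ) :
    |∑ m ∈ Finset.Icc 1 M, oddJacobi n m| ≤ 4 * n := by
  have hv : ∀ m : ℕ, jacobiBottom n (m : ZMod (4 * n)) = (oddJacobi n m : ℂ) := by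
    intro m
    rw [jacobiBottom_natCast hn, oddJacobi]
    split_ifs <;> simp
  have : NeZero (4 * n) := ⟨by omega⟩
  obtain ⟨m, hm, hJ⟩ := exists_odd_jacobiSym_eq_neg_one hn hsq
  have hχ : jacobiBottom n ≠ 1 := DirichletCharacter.ne_one_of_apply_natCast (n := m) (by
    rw [hv, oddJacobi, if_pos hm, hJ]; norm_num)
  have h := norm_sum_Ioc_le_of_ne_one hχ 0 M
  simp_rw [hv] at h
  rw [← Complex.ofReal_sum, Complex.norm_real] at h
  push_cast at h
  exact h

theorem abs_sum_oddJacobi_left_le {k : ℕ} (hk : Odd k) (hsq : ¬ IsSquare k) (A B : ℕ) :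
    |∑ n ∈ Finset.Ioc A B, oddJacobi n k| ≤ k := by
  have hk0 : k ≠ 0 := hk.pos.ne'
  have hv : ∀ m : ℕ, jacobiTop k (m : ZMod k) = (oddJacobi m k : ℂ) := by
    intro m
    rw [jacobiTop_natCast hk0, oddJacobi, if_pos hk]
    simp
  have : NeZero k := ⟨hk0⟩
  obtain ⟨m, -, hJ⟩ := exists_modEq_one_jacobiSym_eq_neg_one hk hsq (Nat.coprime_one_left k)
  have hχ : jacobiTop k ≠ 1 := DirichletCharacter.ne_one_of_apply_natCast (n := m) (by
    rw [hv, oddJacobi, if_pos hk, hJ]; norm_num)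
  have h := norm_sum_Ioc_le_of_ne_one hχ A B
  simp_rw [hv] at h
  rwa [← Complex.ofReal_sum, Complex.norm_real] at h

/-! ### A lower bound for the denominator of Selberg's sieve. -/

/-- The positive integers up to `x` all of whose prime factors lie in `A`. -/
def smoothUpTo (A : Finset ℕ) (x : ℕ) : Finset ℕ :=
  (Finset.Icc 1 x).filter fun n => n.primeFactors ⊆ A

/-- The squarefree integers up to `x` all of whose prime factors lie in `A`. -/
def sqfreeSmoothUpTo (A : Finset ℕ) (x : ℕ) : Finset ℕ :=
  (smoothUpTo A x).filter Squarefree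

/-- The sum of `1 / φ(d)` over the squarefree `d ≤ x` composed of primes in `A`. -/
noncomputable def selbergSum (A : Finset ℕ) (x : ℕ) : ℝ :=
  ∑ d ∈ sqfreeSmoothUpTo A x, 1 / (d.totient : ℝ)

theorem mem_smoothUpTo {A : Finset ℕ} {x n : ℕ} :
    n ∈ smoothUpTo A x ↔ (1 ≤ n ∧ n ≤ x) ∧ n.primeFactors ⊆ A := by
  simp [smoothUpTo]

theorem mem_sqfreeSmoothUpTo {A : Finset ℕ} {x n : ℕ} :
    n ∈ sqfreeSmoothUpTo A x ↔ ((1 ≤ n ∧ n ≤ x) ∧ n.primeFactors ⊆ A) ∧ Squarefree n := by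
  simp [sqfreeSmoothUpTo, mem_smoothUpTo]

theorem sum_smoothUpTo_insert_le {p : ℕ} (hp : p.Prime) (A : Finset ℕ) (x : ℕ) :
    ∑ n ∈ smoothUpTo (insert p A) x, 1 / (n : ℝ) ≤
      ∑ n ∈ smoothUpTo A x, 1 / (n : ℝ) +
        1 / p * ∑ n ∈ smoothUpTo (insert p A) (x / p), 1 / (n : ℝ) := by
  have hsub : smoothUpTo (insert p A) x ⊆
      smoothUpTo A x ∪ (smoothUpTo (insert p A) (x / p)).image (p * ·) := by
    intro n hn
    rw [mem_smoothUpTo] at hn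
    obtain ⟨⟨h1, h2⟩, h3⟩ := hn
    rw [Finset.mem_union]
    by_cases hpn : p ∣ n
    · right
      obtain ⟨m, rfl⟩ := hpn
      have hm : m ≠ 0 := by rintro rfl; simp at h1
      refine Finset.mem_image.mpr ⟨m, mem_smoothUpTo.mpr ⟨⟨Nat.pos_of_ne_zero hm, ?_⟩, ?_⟩, rfl⟩
      · rw [Nat.le_div_iff_mul_le hp.pos, mul_comm]; exact h2
      · exact (Nat.primeFactors_mono (Dvd.intro_left p rfl) (by omega)).trans h3
    · left
      refine mem_smoothUpTo.mpr ⟨⟨h1, h2⟩, fun r hr => ?_⟩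
      rcases Finset.mem_insert.mp (h3 hr) with rfl | h
      · exact absurd (Nat.dvd_of_mem_primeFactors hr) hpn
      · exact h
  calc _ ≤ ∑ n ∈ smoothUpTo A x ∪ (smoothUpTo (insert p A) (x / p)).image (p * ·), 1 / (n : ℝ) :=
        Finset.sum_le_sum_of_subset_of_nonneg hsub fun _ _ _ => by positivity
    _ ≤ ∑ n ∈ smoothUpTo A x, 1 / (n : ℝ) +
        ∑ n ∈ (smoothUpTo (insert p A) (x / p)).image (p * ·), 1 / (n : ℝ) := by
        rw [← Finset.sum_union_inter]
        exact le_add_of_nonneg_right (Finset.sum_nonneg fun _ _ => by positivity)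
    _ = _ := by
        rw [Finset.sum_image (fun a _ b _ h => Nat.eq_of_mul_eq_mul_left hp.pos h),
          Finset.mul_sum]
        congr 1
        refine Finset.sum_congr rfl fun n _ => ?_
        push_cast
        rw [one_div_mul_one_div]

theorem selbergSum_insert_ge {p : ℕ} (hp : p.Prime) {A : Finset ℕ} (hpA : p ∉ A) (x : ℕ) :
    selbergSum A x + 1 / ((p : ℝ) - 1) * selbergSum A (x / p) ≤ selbergSum (insert p A) x := by
  have hnd : ∀ n ∈ sqfreeSmoothUpTo A (x / p), p.Coprime n := by
    intro n hn
    obtain ⟨⟨⟨h1, -⟩, h3⟩, -⟩ := mem_sqfreeSmoothUpTo.mp hn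
    refine (Nat.Prime.coprime_iff_not_dvd hp).mpr fun h => hpA (h3 ?_)
    exact Nat.mem_primeFactors.mpr ⟨hp, h, by omega⟩
  have hdisj : Disjoint (sqfreeSmoothUpTo A x) ((sqfreeSmoothUpTo A (x / p)).image (p * ·)) := by
    rw [Finset.disjoint_left]
    rintro n hn hn'
    obtain ⟨m, -, rfl⟩ := Finset.mem_image.mp hn'
    obtain ⟨⟨⟨h1, -⟩, h3⟩, -⟩ := mem_sqfreeSmoothUpTo.mp hn
    exact hpA (h3 (Nat.mem_primeFactors.mpr ⟨hp, Dvd.intro _ rfl, by omega⟩))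
  have hsub : sqfreeSmoothUpTo A x ∪ (sqfreeSmoothUpTo A (x / p)).image (p * ·) ⊆
      sqfreeSmoothUpTo (insert p A) x := by
    intro n hn
    rcases Finset.mem_union.mp hn with h | h
    · obtain ⟨⟨h1, h3⟩, h4⟩ := mem_sqfreeSmoothUpTo.mp h
      exact mem_sqfreeSmoothUpTo.mpr ⟨⟨h1, h3.trans (Finset.subset_insert _ _)⟩, h4⟩
    · obtain ⟨m, hm, rfl⟩ := Finset.mem_image.mp h
      have hc := hnd m hm
      obtain ⟨⟨⟨h1, h2⟩, h3⟩, h4⟩ := mem_sqfreeSmoothUpTo.mp hm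
      refine mem_sqfreeSmoothUpTo.mpr ⟨⟨⟨Nat.mul_pos hp.pos h1, ?_⟩, ?_⟩, ?_⟩
      · rwa [Nat.le_div_iff_mul_le hp.pos, mul_comm] at h2
      · rw [Nat.primeFactors_mul hp.ne_zero (by omega), hp.primeFactors]
        exact Finset.union_subset (by simp) (h3.trans (Finset.subset_insert _ _))
      · exact (Nat.squarefree_mul hc).mpr ⟨hp.prime.squarefree, h4⟩
  unfold selbergSum
  calc _ = ∑ d ∈ sqfreeSmoothUpTo A x ∪ (sqfreeSmoothUpTo A (x / p)).image (p * ·),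
        1 / (d.totient : ℝ) := by
        rw [Finset.sum_union hdisj,
          Finset.sum_image (fun a _ b _ h => Nat.eq_of_mul_eq_mul_left hp.pos h), Finset.mul_sum]
        congr 1
        refine Finset.sum_congr rfl fun n hn => ?_
        rw [Nat.totient_mul (hnd n hn), Nat.totient_prime hp]
        push_cast [hp.one_le]
        rw [one_div_mul_one_div]
    _ ≤ _ := Finset.sum_le_sum_of_subset_of_nonneg hsub fun _ _ _ => by positivity

/-- Morally 1/φ(d) is the sum of 1/n over all `n` with radical `d`, and every n ≤ x has radical at
most `x`. The proof instead adds the primes of `A` one at a time, comparing the two recursions for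
`insert p A`. -/
theorem sum_smoothUpTo_le_selbergSum (A : Finset ℕ) (hA : ∀ p ∈ A, p.Prime) (x : ℕ) :
    ∑ n ∈ smoothUpTo A x, 1 / (n : ℝ) ≤ selbergSum A x := by
  induction A using Finset.induction_on generalizing x with
  | empty =>
    have hsub : smoothUpTo ∅ x ⊆ sqfreeSmoothUpTo ∅ x := by
      intro n hn
      refine Finset.mem_filter.mpr ⟨hn, ?_⟩
      obtain ⟨⟨h1, -⟩, h3⟩ := mem_smoothUpTo.mp hn
      have : n = 1 := by
        have := Nat.primeFactors_eq_empty.mp (Finset.subset_empty.mp h3)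
        omega
      subst this
      exact squarefree_one
    calc _ ≤ ∑ n ∈ smoothUpTo ∅ x, 1 / (n.totient : ℝ) := by
          refine Finset.sum_le_sum fun n hn => ?_
          have h1 := (mem_smoothUpTo.mp hn).1.1
          have := Nat.totient_pos.mpr h1
          exact one_div_le_one_div_of_le (by exact_mod_cast this)
            (by exact_mod_cast Nat.totient_le n)
      _ ≤ _ := Finset.sum_le_sum_of_subset_of_nonneg hsub fun _ _ _ => by positivity
  | insert p A hpA ih =>
    have hp : p.Prime := hA p (Finset.mem_insert_self _ _)
    have ih' := ih fun r hr => hA r (Finset.mem_insert_of_mem hr)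
    induction x using Nat.strong_induction_on with
    | _ x ihx =>
      rcases Nat.eq_zero_or_pos x with rfl | hx
      · simp [smoothUpTo, selbergSum, sqfreeSmoothUpTo]
      have hp1 : (1 : ℝ) < p := by exact_mod_cast hp.one_lt
      have h1 := sum_smoothUpTo_insert_le hp A x
      have h2 : ∑ n ∈ smoothUpTo (insert p A) (x / p), 1 / (n : ℝ) ≤
          selbergSum A (x / p) + 1 / (p - 1) * selbergSum A (x / p) := by
        rcases Nat.eq_zero_or_pos (x / p) with h0 | h0
        · rw [h0]; simp [smoothUpTo, selbergSum, sqfreeSmoothUpTo]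
        have h3 := sum_smoothUpTo_insert_le hp A (x / p)
        have h4 : ∑ n ∈ smoothUpTo (insert p A) (x / p), 1 / (n : ℝ) ≤
            ∑ n ∈ smoothUpTo A (x / p), 1 / (n : ℝ) +
              1 / p * ∑ n ∈ smoothUpTo (insert p A) (x / p), 1 / (n : ℝ) := by
          refine h3.trans (add_le_add_right (mul_le_mul_of_nonneg_left ?_ (by positivity)) _)
          refine Finset.sum_le_sum_of_subset_of_nonneg ?_ fun _ _ _ => by positivity
          intro n hn
          obtain ⟨⟨a, b⟩, c⟩ := mem_smoothUpTo.mp hn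
          exact mem_smoothUpTo.mpr ⟨⟨a, b.trans (Nat.div_le_self _ _)⟩, c⟩
        have h5 := ih' (x / p)
        set V := ∑ n ∈ smoothUpTo (insert p A) (x / p), 1 / (n : ℝ)
        set F := selbergSum A (x / p)
        -- The term V/p is absorbed on the left: V ≤ F·p/(p-1) = F + F/(p-1).
        have h6 : V ≤ F + 1 / p * V := by linarith
        have h7 : F + 1 / ((p : ℝ) - 1) * F = F * p / (p - 1) := by
          have : (p : ℝ) - 1 ≠ 0 := by linarith
          field_simp; ring
        rw [h7, le_div_iff₀ (by linarith)]
        have h8 : (1 / (p : ℝ) * V) * p = V := by field_simp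
        nlinarith
      have h9 := selbergSum_insert_ge hp hpA x
      have h10 : 1 / (p : ℝ) * (selbergSum A (x / p) + 1 / (p - 1) * selbergSum A (x / p)) =
          1 / ((p : ℝ) - 1) * selbergSum A (x / p) := by
        have : (p : ℝ) - 1 ≠ 0 := by linarith
        field_simp; ring
      have h11 := mul_le_mul_of_nonneg_left h2 (by positivity : (0 : ℝ) ≤ 1 / p)
      linarith [ih' x]

theorem sum_smoothUpTo_insert_le_mul {p : ℕ} (hp : p.Prime) (A : Finset ℕ) (x : ℕ) :
    ∑ n ∈ smoothUpTo (insert p A) x, 1 / (n : ℝ) ≤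
      (1 - 1 / (p : ℝ))⁻¹ * ∑ n ∈ smoothUpTo A x, 1 / (n : ℝ) := by
  have h3 := sum_smoothUpTo_insert_le hp A x
  have h4 : ∑ n ∈ smoothUpTo (insert p A) (x / p), 1 / (n : ℝ) ≤
      ∑ n ∈ smoothUpTo (insert p A) x, 1 / (n : ℝ) := by
    refine Finset.sum_le_sum_of_subset_of_nonneg ?_ fun _ _ _ => by positivity
    intro n hn
    obtain ⟨⟨a, b⟩, c⟩ := mem_smoothUpTo.mp hn
    exact mem_smoothUpTo.mpr ⟨⟨a, b.trans (Nat.div_le_self _ _)⟩, c⟩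
  have hp1 : (1 : ℝ) < p := by exact_mod_cast hp.one_lt
  have h5 : 0 < 1 - 1 / (p : ℝ) := by
    rw [sub_pos, div_lt_one (by linarith)]; exact hp1
  rw [inv_mul_eq_div, le_div_iff₀ h5]
  have h6 := mul_le_mul_of_nonneg_left h4 (by positivity : (0 : ℝ) ≤ 1 / p)
  linarith

/-- Enlarging `Q` by a prime `p` multiplies the sum of 1/n by at most the Euler factor at `p`. Once
all primes up to `D` are present, the sum is the full harmonic sum. -/
theorem log_le_selbergSum_mul_prod {D : ℕ} {Q : Finset ℕ}
    (hQ : Q ⊆ (Finset.Icc 1 D).filter Nat.Prime) :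
    Real.log (D + 1) ≤ selbergSum Q D *
      ∏ p ∈ (Finset.Icc 1 D).filter Nat.Prime \ Q, (1 - 1 / (p : ℝ))⁻¹ := by
  set P := (Finset.Icc 1 D).filter Nat.Prime with hP
  have hprime : ∀ p ∈ P, p.Prime := fun p hp => (Finset.mem_filter.mp hp).2
  have key : ∀ B : Finset ℕ, B ⊆ P → ∑ n ∈ smoothUpTo (B ∪ Q) D, 1 / (n : ℝ) ≤
      selbergSum Q D * ∏ p ∈ B, (1 - 1 / (p : ℝ))⁻¹ := by
    intro B
    induction B using Finset.induction_on with
    | empty =>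
      intro _
      simpa using sum_smoothUpTo_le_selbergSum Q (fun p hp => hprime p (hQ hp)) D
    | insert p B hpB ih =>
      intro hB
      have hp := hprime p (hB (Finset.mem_insert_self _ _))
      have h1 := ih ((Finset.subset_insert _ _).trans hB)
      rw [Finset.insert_union, Finset.prod_insert hpB]
      have hp1 : (1 : ℝ) < p := by exact_mod_cast hp.one_lt
      have h5 : 0 ≤ 1 - 1 / (p : ℝ) := by
        rw [sub_nonneg, div_le_one (by linarith)]; exact hp1.le
      calc _ ≤ (1 - 1 / (p : ℝ))⁻¹ * ∑ n ∈ smoothUpTo (B ∪ Q) D, 1 / (n : ℝ) :=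
            sum_smoothUpTo_insert_le_mul hp _ _
        _ ≤ (1 - 1 / (p : ℝ))⁻¹ * (selbergSum Q D * ∏ p ∈ B, (1 - 1 / (p : ℝ))⁻¹) :=
            mul_le_mul_of_nonneg_left h1 (inv_nonneg.mpr h5)
        _ = _ := by ring
  have h := key (P \ Q) Finset.sdiff_subset
  rw [Finset.sdiff_union_of_subset hQ] at h
  have h2 : smoothUpTo P D = Finset.Icc 1 D := by
    ext n
    rw [mem_smoothUpTo, Finset.mem_Icc]
    refine ⟨fun h => h.1, fun h => ⟨h, fun r hr => ?_⟩⟩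
    refine Finset.mem_filter.mpr ⟨Finset.mem_Icc.mpr ⟨(Nat.prime_of_mem_primeFactors hr).one_le,
      (Nat.le_of_mem_primeFactors hr).trans h.2⟩, Nat.prime_of_mem_primeFactors hr⟩
  rw [h2] at h
  refine le_trans ?_ h
  have := log_add_one_le_harmonic D
  rw [harmonic_eq_sum_Icc] at this
  push_cast at this
  simpa [one_div] using this

theorem one_le_selbergSum {D : ℕ} (hD : 1 ≤ D) (Q : Finset ℕ) : 1 ≤ selbergSum Q D := by
  have h1 : 1 ∈ sqfreeSmoothUpTo Q D :=
    mem_sqfreeSmoothUpTo.mpr ⟨⟨⟨le_rfl, hD⟩, by simp⟩, squarefree_one⟩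
  have := Finset.single_le_sum (f := fun d : ℕ => 1 / (d.totient : ℝ))
    (fun _ _ => by positivity) h1
  simpa [selbergSum] using this

/-! ### Selberg's weights and the minimum of their quadratic form. -/

/-- The Selberg sieve weight for the set of primes `Q` and level `D`. -/
noncomputable def selbergWeight (Q : Finset ℕ) (D d : ℕ) : ℝ :=
  ArithmeticFunction.moebius d * d / selbergSum Q D *
    ∑ k ∈ (sqfreeSmoothUpTo Q D).filter (d ∣ ·), 1 / (k.totient : ℝ)

theorem selbergWeight_one {D : ℕ} (hD : 1 ≤ D) (Q : Finset ℕ) : selbergWeight Q D 1 = 1 := by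
  have h := one_le_selbergSum hD Q
  have : ∑ k ∈ (sqfreeSmoothUpTo Q D).filter (1 ∣ ·), 1 / (k.totient : ℝ) = selbergSum Q D := by
    simp [selbergSum]
  rw [selbergWeight, this]
  simp
  field_simp

/-- Crude, but sufficient: the level will be a small power of `N`, so polynomial losses in `D` are
harmless. -/
theorem abs_selbergWeight_le {D : ℕ} (hD : 1 ≤ D) (Q : Finset ℕ) (d : ℕ) :
    |selbergWeight Q D d| ≤ d := by
  have h := one_le_selbergSum hD Q
  have h1 : ∑ k ∈ (sqfreeSmoothUpTo Q D).filter (d ∣ ·), 1 / (k.totient : ℝ) ≤ selbergSum Q D :=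
    Finset.sum_le_sum_of_subset_of_nonneg (Finset.filter_subset _ _) fun _ _ _ => by positivity
  have h0 : 0 ≤ ∑ k ∈ (sqfreeSmoothUpTo Q D).filter (d ∣ ·), 1 / (k.totient : ℝ) :=
    Finset.sum_nonneg fun _ _ => by positivity
  have hμ : |(ArithmeticFunction.moebius d : ℝ)| ≤ 1 := by
    exact_mod_cast ArithmeticFunction.abs_moebius_le_one (n := d)
  rw [selbergWeight, abs_mul, abs_div, abs_mul, Nat.abs_cast, abs_of_nonneg h0,
    abs_of_pos (by linarith : 0 < selbergSum Q D), div_mul_eq_mul_div, div_le_iff₀ (by linarith)]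
  calc _ ≤ 1 * (d : ℝ) * selbergSum Q D := by gcongr
    _ = _ := by ring

/-- Möbius inversion on the interval between `k` and `l` in the divisor lattice; it serves to
diagonalize the weights. -/
theorem sum_moebius_between {k l : ℕ} (hl : Squarefree l) (hkl : k ∣ l) :
    ∑ d ∈ l.divisors.filter (k ∣ ·), ArithmeticFunction.moebius d =
      if k = l then ArithmeticFunction.moebius k else 0 := by
  obtain ⟨e, rfl⟩ := hkl
  have hk0 : k ≠ 0 := by rintro rfl; simp at hl
  have he0 : e ≠ 0 := by rintro rfl; simp at hl
  have hset : (k * e).divisors.filter (k ∣ ·) = e.divisors.image (k * ·) := by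
    ext d
    simp only [Finset.mem_filter, Nat.mem_divisors, Finset.mem_image]
    constructor
    · rintro ⟨⟨h1, -⟩, c, rfl⟩
      exact ⟨c, ⟨Nat.dvd_of_mul_dvd_mul_left (Nat.pos_of_ne_zero hk0) h1, he0⟩, rfl⟩
    · rintro ⟨c, ⟨h1, -⟩, rfl⟩
      exact ⟨⟨Nat.mul_dvd_mul_left k h1, by positivity⟩, Dvd.intro _ rfl⟩
  rw [hset, Finset.sum_image
    (fun a _ b _ h => Nat.eq_of_mul_eq_mul_left (Nat.pos_of_ne_zero hk0) h)]
  have hc := Nat.coprime_of_squarefree_mul hl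
  have : ∀ c ∈ e.divisors, ArithmeticFunction.moebius (k * c) =
      ArithmeticFunction.moebius k * ArithmeticFunction.moebius c := fun c hcm =>
    ArithmeticFunction.isMultiplicative_moebius.map_mul_of_coprime
      (hc.coprime_dvd_right (Nat.dvd_of_mem_divisors hcm))
  rw [Finset.sum_congr rfl this, ← Finset.mul_sum]
  have h2 := congrArg (fun f : ArithmeticFunction ℤ => f e)
    ArithmeticFunction.moebius_mul_coe_zeta
  simp only [ArithmeticFunction.coe_mul_zeta_apply, ArithmeticFunction.one_apply] at h2
  rw [h2]
  by_cases h : e = 1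
  · simp [h]
  · rw [if_neg h, if_neg, mul_zero]
    intro h'
    apply h
    have : k * 1 = k * e := by omega
    exact (Nat.eq_of_mul_eq_mul_left (Nat.pos_of_ne_zero hk0) this).symm

theorem mem_sqfreeSmoothUpTo_of_dvd {Q : Finset ℕ} {D d l : ℕ} (hl : l ∈ sqfreeSmoothUpTo Q D)
    (hd : d ∣ l) : d ∈ sqfreeSmoothUpTo Q D := by
  obtain ⟨⟨⟨h1, h2⟩, h3⟩, h4⟩ := mem_sqfreeSmoothUpTo.mp hl
  have hl0 : l ≠ 0 := by omega
  exact mem_sqfreeSmoothUpTo.mpr ⟨⟨⟨Nat.pos_of_dvd_of_pos hd h1, (Nat.le_of_dvd h1 hd).trans h2⟩,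
    (Nat.primeFactors_mono hd hl0).trans h3⟩, h4.squarefree_of_dvd hd⟩

theorem sum_selbergWeight_div {Q : Finset ℕ} {D k : ℕ} (hk : k ∈ sqfreeSmoothUpTo Q D) :
    ∑ d ∈ (sqfreeSmoothUpTo Q D).filter (k ∣ ·), selbergWeight Q D d / d =
      ArithmeticFunction.moebius k / (selbergSum Q D * k.totient) := by
  set T := sqfreeSmoothUpTo Q D with hT
  have h1 : ∀ d ∈ T.filter (k ∣ ·), selbergWeight Q D d / d =
      ∑ l ∈ T, if d ∣ l then
        (1 / selbergSum Q D) * (ArithmeticFunction.moebius d * (1 / (l.totient : ℝ))) else 0 := by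
    intro d hd
    have hd0 : (d : ℝ) ≠ 0 := by
      have := (mem_sqfreeSmoothUpTo.mp (Finset.mem_filter.mp hd).1).1.1.1
      positivity
    rw [← Finset.sum_filter, ← Finset.mul_sum, ← Finset.mul_sum, selbergWeight,
      ← hT]
    field_simp
  rw [Finset.sum_congr rfl h1, Finset.sum_comm]
  have h2 : ∀ l ∈ T, (∑ d ∈ T.filter (k ∣ ·), if d ∣ l then
        (1 / selbergSum Q D) * (ArithmeticFunction.moebius d * (1 / (l.totient : ℝ))) else 0) =
      if k = l then ArithmeticFunction.moebius k / (selbergSum Q D * k.totient) else 0 := by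
    intro l hl
    obtain ⟨⟨⟨hl1, hl2⟩, hl3⟩, hl4⟩ := mem_sqfreeSmoothUpTo.mp hl
    rw [← Finset.sum_filter, ← Finset.mul_sum, ← Finset.sum_mul]
    by_cases hkl : k ∣ l
    · have hset : (T.filter (k ∣ ·)).filter (· ∣ l) = l.divisors.filter (k ∣ ·) := by
        ext d
        simp only [Finset.mem_filter, Nat.mem_divisors]
        constructor
        · rintro ⟨⟨-, a⟩, b⟩; exact ⟨⟨b, by omega⟩, a⟩
        · rintro ⟨⟨b, -⟩, a⟩; exact ⟨⟨mem_sqfreeSmoothUpTo_of_dvd hl b, a⟩, b⟩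
      have h := sum_moebius_between hl4 hkl
      have h' : ∑ d ∈ l.divisors.filter (k ∣ ·), (ArithmeticFunction.moebius d : ℝ) =
          if k = l then (ArithmeticFunction.moebius k : ℝ) else 0 := by
        have := congrArg (fun z : ℤ => (z : ℝ)) h
        simpa using this
      rw [hset, h']
      split_ifs with hkl'
      · subst hkl'
        rw [div_eq_mul_one_div _ (selbergSum Q D * _), ← one_div_mul_one_div]; ring
      · simp
    · have hset : (T.filter (k ∣ ·)).filter (· ∣ l) = ∅ := by
        rw [Finset.filter_eq_empty_iff]
        intro d hd hdl
        exact hkl ((Finset.mem_filter.mp hd).2.trans hdl)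
      rw [hset, if_neg (by rintro rfl; exact hkl dvd_rfl)]
      simp
  rw [Finset.sum_congr rfl h2, Finset.sum_ite_eq, if_pos hk]

/-- Since 1/lcm = gcd/(d₁d₂) and gcd = ∑ φ(k) over common divisors `k`, the form is ∑ φ(k) y_k² with
y_k = ∑_{k ∣ d} λ_d/d. By `sum_selbergWeight_div`, y_k = μ(k)/(Sφ(k)), and the squares add up to
S/S². -/
theorem sum_selbergWeight_lcm {D : ℕ} (hD : 1 ≤ D) (Q : Finset ℕ) :
    ∑ d₁ ∈ sqfreeSmoothUpTo Q D, ∑ d₂ ∈ sqfreeSmoothUpTo Q D,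
      selbergWeight Q D d₁ * selbergWeight Q D d₂ / (d₁.lcm d₂ : ℝ) = 1 / selbergSum Q D := by
  set T := sqfreeSmoothUpTo Q D with hT
  have hS := one_le_selbergSum hD Q
  have h1 : ∀ d₁ ∈ T, ∀ d₂ ∈ T,
      selbergWeight Q D d₁ * selbergWeight Q D d₂ / (d₁.lcm d₂ : ℝ) =
      ∑ k ∈ T, (k.totient : ℝ) * ((if k ∣ d₁ then selbergWeight Q D d₁ / d₁ else 0) *
        (if k ∣ d₂ then selbergWeight Q D d₂ / d₂ else 0)) := by
    intro d₁ hd₁ d₂ hd₂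
    have p1 := (mem_sqfreeSmoothUpTo.mp hd₁).1.1.1
    have p2 := (mem_sqfreeSmoothUpTo.mp hd₂).1.1.1
    have hg : ((d₁.gcd d₂ : ℕ) : ℝ) = ∑ k ∈ (d₁.gcd d₂).divisors, (k.totient : ℝ) := by
      exact_mod_cast (Nat.sum_totient _).symm
    have hset : (d₁.gcd d₂).divisors = T.filter (fun k => k ∣ d₁ ∧ k ∣ d₂) := by
      ext k
      simp only [Nat.mem_divisors, Finset.mem_filter, Nat.dvd_gcd_iff]
      constructor
      · rintro ⟨⟨a, b⟩, -⟩; exact ⟨mem_sqfreeSmoothUpTo_of_dvd hd₁ a, a, b⟩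
      · rintro ⟨-, a, b⟩; exact ⟨⟨a, b⟩, (Nat.gcd_pos_of_pos_left _ p1).ne'⟩
    have h3 : ∀ k ∈ T, (k.totient : ℝ) * ((if k ∣ d₁ then selbergWeight Q D d₁ / d₁ else 0) *
        (if k ∣ d₂ then selbergWeight Q D d₂ / d₂ else 0)) =
        if k ∣ d₁ ∧ k ∣ d₂ then (k.totient : ℝ) * (selbergWeight Q D d₁ / d₁ *
          (selbergWeight Q D d₂ / d₂)) else 0 := by
      intro k _
      by_cases a : k ∣ d₁ <;> by_cases b : k ∣ d₂ <;> simp [a, b]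
    rw [Finset.sum_congr rfl h3, ← Finset.sum_filter, ← hset, ← Finset.sum_mul, ← hg]
    have h4 : (d₁.gcd d₂ : ℝ) * (d₁.lcm d₂ : ℝ) = d₁ * d₂ := by
      exact_mod_cast Nat.gcd_mul_lcm d₁ d₂
    have h5 : (d₁.lcm d₂ : ℝ) ≠ 0 := by
      have := Nat.lcm_pos p1 p2
      positivity
    have q1 : (d₁ : ℝ) ≠ 0 := by positivity
    have q2 : (d₂ : ℝ) ≠ 0 := by positivity
    field_simp
    linear_combination (-(selbergWeight Q D d₁ * selbergWeight Q D d₂)) * h4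
  have h2 : ∑ d₁ ∈ T, ∑ d₂ ∈ T,
      selbergWeight Q D d₁ * selbergWeight Q D d₂ / (d₁.lcm d₂ : ℝ) =
      ∑ k ∈ T, (k.totient : ℝ) *
        (∑ d ∈ T, if k ∣ d then selbergWeight Q D d / d else 0) ^ 2 := by
    rw [Finset.sum_congr rfl fun d₁ hd₁ => Finset.sum_congr rfl fun d₂ hd₂ => h1 d₁ hd₁ d₂ hd₂]
    rw [Finset.sum_congr rfl fun d₁ _ => Finset.sum_comm, Finset.sum_comm]
    refine Finset.sum_congr rfl fun k _ => ?_
    rw [sq, Finset.sum_mul_sum, Finset.mul_sum]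
    refine Finset.sum_congr rfl fun d₁ _ => ?_
    rw [Finset.mul_sum]
  rw [h2]
  have h3 : ∀ k ∈ T, (k.totient : ℝ) *
        (∑ d ∈ T, if k ∣ d then selbergWeight Q D d / d else 0) ^ 2 =
      1 / selbergSum Q D ^ 2 * (1 / (k.totient : ℝ)) := by
    intro k hk
    obtain ⟨⟨⟨hk1, -⟩, -⟩, hk4⟩ := mem_sqfreeSmoothUpTo.mp hk
    rw [← Finset.sum_filter, sum_selbergWeight_div hk, div_pow]
    have hμ : (ArithmeticFunction.moebius k : ℝ) ^ 2 = 1 := by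
      have := ArithmeticFunction.moebius_sq_eq_one_of_squarefree hk4
      exact_mod_cast this
    have : (k.totient : ℝ) ≠ 0 := by
      have := Nat.totient_pos.mpr hk1
      positivity
    rw [hμ]
    field_simp
  rw [Finset.sum_congr rfl h3, ← Finset.mul_sum, ← selbergSum]
  field_simp

/-! ### The diagonal: pairs whose product is a square. -/

theorem sum_one_div_sq_le (y : ℕ) : ∑ n ∈ Finset.Icc 1 y, 1 / (n : ℝ) ^ 2 ≤ 2 := by
  have key : ∀ y : ℕ, 1 ≤ y → ∑ n ∈ Finset.Icc 1 y, 1 / (n : ℝ) ^ 2 ≤ 2 - 1 / (y : ℝ) := by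
    intro y hy
    induction y, hy using Nat.le_induction with
    | base => norm_num
    | succ k hk ih =>
      rw [Finset.sum_Icc_succ_top (by omega)]
      have h : 1 / ((k + 1 : ℕ) : ℝ) ^ 2 ≤ 1 / (k : ℝ) - 1 / ((k + 1 : ℕ) : ℝ) := by
        have hk' : (0 : ℝ) < k := by positivity
        push_cast
        rw [div_sub_div _ _ hk'.ne' (by positivity), div_le_div_iff₀ (by positivity) (by positivity)]
        nlinarith
      linarith
  rcases Nat.eq_zero_or_pos y with rfl | hy
  · simp
  · have := key y hy
    have : (0 : ℝ) ≤ 1 / (y : ℝ) := by positivity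
    linarith [key y hy]

theorem exists_eq_mul_sq_of_isSquare_mul {a b : ℕ} (ha : a ≠ 0) (hab : IsSquare (a * b)) :
    ∃ g u v : ℕ, a = g * u ^ 2 ∧ b = g * v ^ 2 := by
  have hg := Nat.gcd_pos_of_pos_left b (Nat.pos_of_ne_zero ha)
  obtain ⟨s, hs⟩ := hab
  obtain ⟨a', ha'⟩ := Nat.gcd_dvd_left a b
  obtain ⟨b', hb'⟩ := Nat.gcd_dvd_right a b
  set g := a.gcd b with hgdef
  have hc : Nat.Coprime a' b' := by
    have := Nat.coprime_div_gcd_div_gcd hg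
    rwa [← hgdef, Nat.div_eq_of_eq_mul_right hg ha', Nat.div_eq_of_eq_mul_right hg hb'] at this
  have hgs : g ∣ s := by
    rw [← Nat.pow_dvd_pow_iff (two_ne_zero)]
    exact ⟨a' * b', by rw [sq s, ← hs, ha', hb']; ring⟩
  obtain ⟨t, rfl⟩ := hgs
  have hprod : a' * b' = t ^ 2 := by
    have h1 : g ^ 2 * (a' * b') = g ^ 2 * t ^ 2 := by
      calc g ^ 2 * (a' * b') = (g * a') * (g * b') := by ring
        _ = a * b := by rw [← ha', ← hb']
        _ = _ := by rw [hs]; ring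
    exact Nat.eq_of_mul_eq_mul_left (by positivity) h1
  obtain ⟨u, hu⟩ := exists_eq_pow_of_mul_eq_pow (by rw [Nat.isUnit_iff]; exact hc) hprod
  obtain ⟨v, hv⟩ := exists_eq_pow_of_mul_eq_pow (by rw [Nat.isUnit_iff]; exact hc.symm)
    (by rw [mul_comm]; exact hprod)
  exact ⟨g, u, v, by rw [← hu, ← ha'], by rw [← hv, ← hb']⟩

/-- Such pairs have the form (gu², gv²), and then 1/(ab) = 1/(guv)², so the sum is at most the cube
of ∑ 1/n² ≤ 2. -/
theorem sum_isSquare_mul_le (y : ℕ) :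
    ∑ a ∈ Finset.Icc 1 y, ∑ b ∈ Finset.Icc 1 y,
      (if IsSquare (a * b) then 1 / ((a : ℝ) * b) else 0) ≤ 8 := by
  classical
  set I := Finset.Icc 1 y with hI
  rw [← Finset.sum_product' I I fun a b => if IsSquare (a * b) then 1 / ((a : ℝ) * b) else 0,
    ← Finset.sum_filter]
  have hsub : (I ×ˢ I).filter (fun x => IsSquare (x.1 * x.2)) ⊆
      (I ×ˢ (I ×ˢ I)).image (fun t : ℕ × ℕ × ℕ => (t.1 * t.2.1 ^ 2, t.1 * t.2.2 ^ 2)) := by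
    rintro ⟨a, b⟩ hx
    simp only [Finset.mem_filter, Finset.mem_product, hI, Finset.mem_Icc] at hx
    obtain ⟨⟨⟨a1, a2⟩, b1, b2⟩, hs⟩ := hx
    obtain ⟨g, u, v, rfl, rfl⟩ := exists_eq_mul_sq_of_isSquare_mul (by omega) hs
    have hg : 0 < g := Nat.pos_of_mul_pos_right a1
    have hu : 0 < u := Nat.pos_of_ne_zero (by rintro rfl; simp at a1)
    have hv : 0 < v := Nat.pos_of_ne_zero (by rintro rfl; simp at b1)
    refine Finset.mem_image.mpr ⟨(g, u, v), ?_, rfl⟩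
    simp only [Finset.mem_product, hI, Finset.mem_Icc]
    exact ⟨⟨hg, by nlinarith [Nat.pow_pos (n := 2) hu]⟩, ⟨hu, by nlinarith⟩, ⟨hv, by nlinarith⟩⟩
  calc _ ≤ ∑ x ∈ (I ×ˢ (I ×ˢ I)).image (fun t : ℕ × ℕ × ℕ => (t.1 * t.2.1 ^ 2, t.1 * t.2.2 ^ 2)),
        1 / ((x.1 : ℝ) * x.2) :=
        Finset.sum_le_sum_of_subset_of_nonneg hsub fun _ _ _ => by positivity
    _ ≤ ∑ t ∈ I ×ˢ (I ×ˢ I),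
        1 / (((t.1 * t.2.1 ^ 2 : ℕ) : ℝ) * ((t.1 * t.2.2 ^ 2 : ℕ) : ℝ)) := by
        exact Finset.sum_image_le_of_nonneg (s := I ×ˢ (I ×ˢ I))
          (g := fun t : ℕ × ℕ × ℕ => (t.1 * t.2.1 ^ 2, t.1 * t.2.2 ^ 2))
          (f := fun x : ℕ × ℕ => 1 / ((x.1 : ℝ) * x.2)) fun _ _ => by positivity
    _ = (∑ n ∈ I, 1 / (n : ℝ) ^ 2) ^ 3 := by
        rw [pow_succ', sq, Finset.sum_mul_sum, ← Finset.sum_product', Finset.sum_mul_sum,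
          ← Finset.sum_product']
        refine Finset.sum_congr rfl fun t _ => ?_
        push_cast
        rw [one_div_mul_one_div, one_div_mul_one_div]
        congr 1
        ring
    _ ≤ 2 ^ 3 := by
        gcongr
        exact sum_one_div_sq_le y
    _ = 8 := by norm_num

theorem sum_dvd_Icc {M : Type*} [AddCommMonoid M] {e : ℕ} (he : 0 < e) (N : ℕ) (g : ℕ → M) :
    ∑ m ∈ (Finset.Icc 1 N).filter (e ∣ ·), g m = ∑ k ∈ Finset.Icc 1 (N / e), g (e * k) := by
  rw [← Finset.sum_image (f := g) (g := (e * ·))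
    (fun a _ b _ h => Nat.eq_of_mul_eq_mul_left he h)]
  congr 1
  ext m
  simp only [Finset.mem_filter, Finset.mem_Icc, Finset.mem_image]
  constructor
  · rintro ⟨⟨h1, h2⟩, k, rfl⟩
    refine ⟨k, ⟨Nat.pos_of_ne_zero (by rintro rfl; simp at h1), ?_⟩, rfl⟩
    rwa [Nat.le_div_iff_mul_le he, mul_comm]
  · rintro ⟨k, ⟨h1, h2⟩, rfl⟩
    rw [Nat.le_div_iff_mul_le he, mul_comm] at h2
    exact ⟨⟨Nat.mul_pos he h1, h2⟩, Dvd.intro _ rfl⟩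

/-! ### Sieve-weighted moments of Jacobi sums. -/

/-- The linear form in the Selberg weights whose square majorizes the indicator function of the
integers free of prime factors in `Q`. -/
noncomputable def selbergForm (Q : Finset ℕ) (D m : ℕ) : ℝ :=
  ∑ d ∈ (sqfreeSmoothUpTo Q D).filter (· ∣ m), selbergWeight Q D d

theorem selbergForm_eq_one {Q : Finset ℕ} {D m : ℕ} (hD : 1 ≤ D)
    (hm : ∀ p ∈ Q, p.Prime → ¬ p ∣ m) : selbergForm Q D m = 1 := by
  have : (sqfreeSmoothUpTo Q D).filter (· ∣ m) = {1} := by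
    ext d
    simp only [Finset.mem_filter, Finset.mem_singleton]
    constructor
    · rintro ⟨hd, hdm⟩
      by_contra h1
      obtain ⟨p, hp, hpd⟩ := Nat.exists_prime_and_dvd h1
      obtain ⟨⟨⟨h1, h2⟩, h3⟩, h4⟩ := mem_sqfreeSmoothUpTo.mp hd
      exact hm p (h3 (Nat.mem_primeFactors.mpr ⟨hp, hpd, by omega⟩)) hp (hpd.trans hdm)
    · rintro rfl
      exact ⟨mem_sqfreeSmoothUpTo.mpr ⟨⟨⟨le_rfl, hD⟩, by simp⟩, squarefree_one⟩, one_dvd _⟩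
  rw [selbergForm, this, Finset.sum_singleton, selbergWeight_one hD]

theorem sum_selbergForm_sq_mul (Q : Finset ℕ) (D N : ℕ) (g : ℕ → ℝ) :
    ∑ m ∈ Finset.Icc 1 N, selbergForm Q D m ^ 2 * g m =
      ∑ d₁ ∈ sqfreeSmoothUpTo Q D, ∑ d₂ ∈ sqfreeSmoothUpTo Q D,
        selbergWeight Q D d₁ * selbergWeight Q D d₂ *
          ∑ k ∈ Finset.Icc 1 (N / d₁.lcm d₂), g (d₁.lcm d₂ * k) := by
  set T := sqfreeSmoothUpTo Q D with hT
  have h1 : ∀ m ∈ Finset.Icc 1 N, selbergForm Q D m ^ 2 * g m =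
      ∑ d₁ ∈ T, ∑ d₂ ∈ T, if d₁.lcm d₂ ∣ m then
        selbergWeight Q D d₁ * selbergWeight Q D d₂ * g m else 0 := by
    intro m _
    rw [selbergForm, Finset.sum_filter, sq, Finset.sum_mul_sum, Finset.sum_mul]
    refine Finset.sum_congr rfl fun d₁ _ => ?_
    rw [Finset.sum_mul]
    refine Finset.sum_congr rfl fun d₂ _ => ?_
    by_cases a : d₁ ∣ m <;> by_cases b : d₂ ∣ m <;> simp [a, b, Nat.lcm_dvd_iff]
  rw [Finset.sum_congr rfl h1, Finset.sum_comm]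
  refine Finset.sum_congr rfl fun d₁ hd₁ => ?_
  rw [Finset.sum_comm]
  refine Finset.sum_congr rfl fun d₂ hd₂ => ?_
  have p1 := (mem_sqfreeSmoothUpTo.mp hd₁).1.1.1
  have p2 := (mem_sqfreeSmoothUpTo.mp hd₂).1.1.1
  rw [← sum_dvd_Icc (Nat.lcm_pos p1 p2) N g, Finset.sum_filter, Finset.mul_sum]
  refine Finset.sum_congr rfl fun m _ => ?_
  split_ifs <;> simp

theorem sum_abs_selbergWeight_mul_le {D : ℕ} (hD : 1 ≤ D) (Q : Finset ℕ) :
    ∑ d₁ ∈ sqfreeSmoothUpTo Q D, ∑ d₂ ∈ sqfreeSmoothUpTo Q D,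
      |selbergWeight Q D d₁ * selbergWeight Q D d₂| ≤ (D : ℝ) ^ 4 := by
  simp_rw [abs_mul]
  rw [← Finset.sum_mul_sum, ← sq]
  have h : ∑ d ∈ sqfreeSmoothUpTo Q D, |selbergWeight Q D d| ≤ (D : ℝ) ^ 2 := by
    calc _ ≤ ∑ d ∈ sqfreeSmoothUpTo Q D, (D : ℝ) := by
          refine Finset.sum_le_sum fun d hd => (abs_selbergWeight_le hD Q d).trans ?_
          exact_mod_cast (mem_sqfreeSmoothUpTo.mp hd).1.1.2
      _ ≤ ∑ d ∈ Finset.Icc 1 D, (D : ℝ) :=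
          Finset.sum_le_sum_of_subset_of_nonneg
            ((Finset.filter_subset _ _).trans (Finset.filter_subset _ _)) fun _ _ _ => by positivity
      _ = (D : ℝ) ^ 2 := by simp [sq]
  calc _ ≤ ((D : ℝ) ^ 2) ^ 2 := by
        gcongr
    _ = _ := by ring

theorem sum_selbergForm_sq_le {D : ℕ} (hD : 1 ≤ D) (Q : Finset ℕ) (N : ℕ) :
    ∑ m ∈ Finset.Icc 1 N, selbergForm Q D m ^ 2 ≤ N / selbergSum Q D + (D : ℝ) ^ 4 := by
  have h := sum_selbergForm_sq_mul Q D N fun _ => 1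
  simp only [mul_one, Finset.sum_const, Nat.card_Icc, Nat.add_sub_cancel, nsmul_eq_mul] at h
  rw [h, div_eq_mul_one_div, ← sum_selbergWeight_lcm hD Q, Finset.mul_sum]
  refine le_trans ?_ (add_le_add_right (sum_abs_selbergWeight_mul_le hD Q) _)
  rw [← Finset.sum_add_distrib]
  refine Finset.sum_le_sum fun d₁ hd₁ => ?_
  rw [Finset.mul_sum, ← Finset.sum_add_distrib]
  refine Finset.sum_le_sum fun d₂ hd₂ => ?_
  have p1 := (mem_sqfreeSmoothUpTo.mp hd₁).1.1.1
  have p2 := (mem_sqfreeSmoothUpTo.mp hd₂).1.1.1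
  have p3 : (0 : ℝ) < (d₁.lcm d₂ : ℝ) := by exact_mod_cast Nat.lcm_pos p1 p2
  set w := selbergWeight Q D d₁ * selbergWeight Q D d₂
  have e1 : ((N / d₁.lcm d₂ : ℕ) : ℝ) ≤ N / (d₁.lcm d₂ : ℝ) := Nat.cast_div_le
  have e2 : (N : ℝ) / (d₁.lcm d₂ : ℝ) - 1 ≤ ((N / d₁.lcm d₂ : ℕ) : ℝ) := by
    rw [sub_le_iff_le_add, div_le_iff₀ p3]
    have := Nat.lt_div_mul_add (a := N) (Nat.lcm_pos p1 p2)
    have h' : (N : ℝ) ≤ ((N / d₁.lcm d₂ * d₁.lcm d₂ + d₁.lcm d₂ : ℕ) : ℝ) := by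
      exact_mod_cast this.le
    push_cast at h' ⊢
    linarith
  have e3 : w * (((N / d₁.lcm d₂ : ℕ) : ℝ) - N / (d₁.lcm d₂ : ℝ)) ≤ |w| * 1 := by
    refine (le_abs_self _).trans ?_
    rw [abs_mul]
    gcongr
    rw [abs_le]
    constructor <;> linarith
  have e4 : (N : ℝ) * (w / (d₁.lcm d₂ : ℝ)) = w * (N / (d₁.lcm d₂ : ℝ)) := by ring
  rw [e4]
  linarith

/-- The symbol is multiplicative in `m`, so the lcm of the two sieve divisors factors out and leaves
a character sum in the cofactor, at most 4n by periodicity. -/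
theorem abs_sum_selbergForm_sq_mul_oddJacobi_le {D : ℕ} (hD : 1 ≤ D) (Q : Finset ℕ) (N : ℕ)
    {n : ℕ} (hn : n ≠ 0) (hsq : ¬ IsSquare n) :
    |∑ m ∈ Finset.Icc 1 N, selbergForm Q D m ^ 2 * oddJacobi n m| ≤ 4 * n * (D : ℝ) ^ 4 := by
  rw [sum_selbergForm_sq_mul]
  calc _ ≤ ∑ d₁ ∈ sqfreeSmoothUpTo Q D, ∑ d₂ ∈ sqfreeSmoothUpTo Q D,
        |selbergWeight Q D d₁ * selbergWeight Q D d₂| * (4 * n) := by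
        refine (Finset.abs_sum_le_sum_abs _ _).trans (Finset.sum_le_sum fun d₁ _ => ?_)
        refine (Finset.abs_sum_le_sum_abs _ _).trans (Finset.sum_le_sum fun d₂ _ => ?_)
        rw [abs_mul]
        gcongr
        simp_rw [oddJacobi_mul_right]
        rw [← Finset.mul_sum, abs_mul]
        calc _ ≤ 1 * |∑ m ∈ Finset.Icc 1 (N / d₁.lcm d₂), oddJacobi n m| := by
              gcongr
              exact abs_oddJacobi_le _ _
          _ ≤ _ := by rw [one_mul]; exact abs_sum_oddJacobi_right_le hn hsq _
    _ = (∑ d₁ ∈ sqfreeSmoothUpTo Q D, ∑ d₂ ∈ sqfreeSmoothUpTo Q D,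
        |selbergWeight Q D d₁ * selbergWeight Q D d₂|) * (4 * n) := by
        simp_rw [Finset.sum_mul]
    _ ≤ (D : ℝ) ^ 4 * (4 * n) := by
        gcongr
        exact sum_abs_selbergWeight_mul_le hD Q
    _ = _ := by ring

/-- The partial sum `∑ a(n) (n / m) / n` over `n ∈ s`, for odd `m`. -/
noncomputable def jacobiSum₁ (a : ℕ → ℂ) (s : Finset ℕ) (m : ℕ) : ℂ :=
  ∑ n ∈ s, a n / n * oddJacobi n m

theorem norm_sq_jacobiSum₁ (a : ℕ → ℂ) (s : Finset ℕ) (m : ℕ) :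
    ((‖jacobiSum₁ a s m‖ ^ 2 : ℝ) : ℂ) =
      ∑ n₁ ∈ s, ∑ n₂ ∈ s, a n₁ / n₁ * (starRingEnd ℂ) (a n₂ / n₂) * oddJacobi (n₁ * n₂) m := by
  push_cast
  rw [← Complex.mul_conj', jacobiSum₁, map_sum, Finset.sum_mul_sum]
  refine Finset.sum_congr rfl fun n₁ _ => Finset.sum_congr rfl fun n₂ _ => ?_
  rw [map_mul, Complex.conj_ofReal, oddJacobi_mul_left]
  push_cast
  ring

theorem sum_selbergForm_sq_mul_norm_sq_le {D : ℕ} (hD : 1 ≤ D) (Q : Finset ℕ) (N y : ℕ)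
    {a : ℕ → ℂ} (ha : ∀ n, ‖a n‖ ≤ 1) :
    ∑ m ∈ Finset.Icc 1 N, selbergForm Q D m ^ 2 * ‖jacobiSum₁ a (Finset.Icc 1 y) m‖ ^ 2 ≤
      8 * (N / selbergSum Q D + (D : ℝ) ^ 4) + 4 * (y : ℝ) ^ 2 * (D : ℝ) ^ 4 := by
  set I := Finset.Icc 1 y with hI
  set B := N / selbergSum Q D + (D : ℝ) ^ 4 with hB
  have hB0 : 0 ≤ B := by
    have := one_le_selbergSum hD Q
    positivity
  -- When `n` is a square there is no oscillation, and only the sieve bound `B` is available.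
  have hG : ∀ n ≠ 0, |∑ m ∈ Finset.Icc 1 N, selbergForm Q D m ^ 2 * oddJacobi n m| ≤
      (if IsSquare n then B else 0) + 4 * n * (D : ℝ) ^ 4 := by
    intro n hn
    split_ifs with h
    · refine le_trans ?_ (le_add_of_nonneg_right (by positivity))
      refine le_trans ?_ (sum_selbergForm_sq_le hD Q N)
      refine (Finset.abs_sum_le_sum_abs _ _).trans (Finset.sum_le_sum fun m _ => ?_)
      rw [abs_mul, abs_of_nonneg (sq_nonneg _)]
      exact mul_le_of_le_one_right (sq_nonneg _) (abs_oddJacobi_le _ _)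
    · rw [zero_add]
      exact abs_sum_selbergForm_sq_mul_oddJacobi_le hD Q N hn h
  have h1 : ((∑ m ∈ Finset.Icc 1 N,
      selbergForm Q D m ^ 2 * ‖jacobiSum₁ a I m‖ ^ 2 : ℝ) : ℂ) =
      ∑ n₁ ∈ I, ∑ n₂ ∈ I, a n₁ / n₁ * (starRingEnd ℂ) (a n₂ / n₂) *
        ((∑ m ∈ Finset.Icc 1 N, selbergForm Q D m ^ 2 * oddJacobi (n₁ * n₂) m : ℝ) : ℂ) := by
    rw [Complex.ofReal_sum]
    have : ∀ m ∈ Finset.Icc 1 N,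
        ((selbergForm Q D m ^ 2 * ‖jacobiSum₁ a I m‖ ^ 2 : ℝ) : ℂ) =
        ∑ n₁ ∈ I, ∑ n₂ ∈ I, a n₁ / n₁ * (starRingEnd ℂ) (a n₂ / n₂) *
          ((selbergForm Q D m ^ 2 * oddJacobi (n₁ * n₂) m : ℝ) : ℂ) := by
      intro m _
      rw [Complex.ofReal_mul, norm_sq_jacobiSum₁, Finset.mul_sum]
      refine Finset.sum_congr rfl fun n₁ _ => ?_
      rw [Finset.mul_sum]
      refine Finset.sum_congr rfl fun n₂ _ => ?_
      push_cast
      ring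
    rw [Finset.sum_congr rfl this, Finset.sum_comm]
    refine Finset.sum_congr rfl fun n₁ _ => ?_
    rw [Finset.sum_comm]
    refine Finset.sum_congr rfl fun n₂ _ => ?_
    rw [← Finset.mul_sum, Complex.ofReal_sum]
  have h2 : ∑ m ∈ Finset.Icc 1 N, selbergForm Q D m ^ 2 * ‖jacobiSum₁ a I m‖ ^ 2 =
      ‖((∑ m ∈ Finset.Icc 1 N,
      selbergForm Q D m ^ 2 * ‖jacobiSum₁ a I m‖ ^ 2 : ℝ) : ℂ)‖ := by
    rw [Complex.norm_real, Real.norm_of_nonneg (Finset.sum_nonneg fun _ _ => by positivity)]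
  rw [h2, h1]
  calc _ ≤ ∑ n₁ ∈ I, ∑ n₂ ∈ I, 1 / ((n₁ : ℝ) * n₂) *
        ((if IsSquare (n₁ * n₂) then B else 0) + 4 * (n₁ * n₂ : ℕ) * (D : ℝ) ^ 4) := by
        refine (norm_sum_le _ _).trans (Finset.sum_le_sum fun n₁ hn₁ => ?_)
        refine (norm_sum_le _ _).trans (Finset.sum_le_sum fun n₂ hn₂ => ?_)
        have p1 := (Finset.mem_Icc.mp hn₁).1
        have p2 := (Finset.mem_Icc.mp hn₂).1
        rw [norm_mul, norm_mul, RCLike.norm_conj, norm_div, norm_div, Complex.norm_natCast,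
          Complex.norm_natCast, Complex.norm_real, Real.norm_eq_abs]
        refine mul_le_mul ?_ (hG _ (by positivity)) (abs_nonneg _) (by positivity)
        rw [div_mul_div_comm]
        gcongr
        exact mul_le_one₀ (ha _) (norm_nonneg _) (ha _)
    _ = B * (∑ n₁ ∈ I, ∑ n₂ ∈ I,
          (if IsSquare (n₁ * n₂) then 1 / ((n₁ : ℝ) * n₂) else 0)) +
        ∑ n₁ ∈ I, ∑ n₂ ∈ I, 4 * (D : ℝ) ^ 4 := by
        rw [Finset.mul_sum, ← Finset.sum_add_distrib]
        refine Finset.sum_congr rfl fun n₁ hn₁ => ?_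
        rw [Finset.mul_sum, ← Finset.sum_add_distrib]
        refine Finset.sum_congr rfl fun n₂ hn₂ => ?_
        have p1 : (0 : ℝ) < n₁ := by exact_mod_cast (Finset.mem_Icc.mp hn₁).1
        have p2 : (0 : ℝ) < n₂ := by exact_mod_cast (Finset.mem_Icc.mp hn₂).1
        push_cast
        split_ifs
        · field_simp
        · field_simp
          ring
    _ ≤ B * 8 + ∑ n₁ ∈ I, ∑ n₂ ∈ I, 4 * (D : ℝ) ^ 4 := by
        gcongr
        exact sum_isSquare_mul_le y
    _ = _ := by
        simp only [Finset.sum_const, hI, Nat.card_Icc, Nat.add_sub_cancel, nsmul_eq_mul]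
        ring

/-! ### From sieve weights to multiplicative weights. -/

theorem multiplicative_le_prod {f : ℕ → ℝ} (h0 : ∀ p, p.Prime → 0 ≤ f p)
    (h1 : ∀ p, p.Prime → f p ≤ 1) {m : ℕ} (hm0 : m ≠ 0)
    (hm : f m = ∏ p ∈ m.primeFactors, f p) {P : Finset ℕ} (hP : ∀ p ∈ P, p.Prime) :
    f m ≤ ∏ p ∈ P, ((if p ∣ m then 0 else 1 - f p) + f p) := by
  -- The two-term form of each factor is kept in the statement because its expansion runs over
  -- subsets `Q` of `P`, and only those `Q` with no element dividing `m` contribute.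
  have e : ∀ p ∈ P, ((if p ∣ m then 0 else 1 - f p) + f p) = if p ∣ m then f p else 1 := by
    intro p _
    split_ifs <;> ring
  rw [Finset.prod_congr rfl e, ← Finset.prod_filter, hm]
  have e2 : P.filter (· ∣ m) = m.primeFactors.filter (· ∈ P) := by
    ext p
    simp only [Finset.mem_filter, Nat.mem_primeFactors]
    constructor
    · rintro ⟨a, b⟩; exact ⟨⟨hP p a, b, hm0⟩, a⟩
    · rintro ⟨⟨-, b, -⟩, a⟩; exact ⟨a, b⟩
  rw [e2, Finset.prod_filter]
  refine Finset.prod_le_prod (fun p hp => h0 p (Nat.prime_of_mem_primeFactors hp)) fun p hp => ?_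
  split_ifs
  · exact le_rfl
  · exact h1 p (Nat.prime_of_mem_primeFactors hp)

/-- The weights `w Q` are the probabilities of a random set containing each prime `p` with
probability 1 - f(p). The sieve loses a factor ∏ (1 - 1/p)⁻¹ over the primes outside `Q`, whose
expectation is the Euler product in the bound. -/
theorem sum_multiplicative_mul_norm_sq_le {f : ℕ → ℝ} (h0 : ∀ p, p.Prime → 0 ≤ f p)
    (h1 : ∀ p, p.Prime → f p ≤ 1) {s : Finset ℕ} {N : ℕ} (hs : s ⊆ Finset.Icc 1 N)
    (hf : ∀ m ∈ s, f m = ∏ p ∈ m.primeFactors, f p) {D : ℕ} (hD : 1 ≤ D)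
    {a : ℕ → ℂ} (ha : ∀ n, ‖a n‖ ≤ 1) :
    ∑ m ∈ s, f m * ‖jacobiSum₁ a (Finset.Icc 1 D) m‖ ^ 2 ≤
      8 * N / Real.log (D + 1) *
        ∏ p ∈ (Finset.Icc 1 D).filter Nat.Prime, (1 + f p / (p - 1)) + 12 * (D : ℝ) ^ 6 := by
  classical
  set P := (Finset.Icc 1 D).filter Nat.Prime with hP
  have hprime : ∀ p ∈ P, p.Prime := fun p hp => (Finset.mem_filter.mp hp).2
  set S := fun m => ‖jacobiSum₁ a (Finset.Icc 1 D) m‖ ^ 2 with hS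
  have hlog : 0 < Real.log (D + 1) := Real.log_pos (by
    have : (1 : ℝ) ≤ D := by exact_mod_cast hD
    linarith)
  have hD1 : (1 : ℝ) ≤ D := by exact_mod_cast hD
  set w : Finset ℕ → ℝ := fun Q => (∏ p ∈ Q, (1 - f p)) * ∏ p ∈ P \ Q, f p with hw
  have hw0 : ∀ Q ∈ P.powerset, 0 ≤ w Q := by
    intro Q hQ
    refine mul_nonneg (Finset.prod_nonneg fun p hp => ?_) (Finset.prod_nonneg fun p hp => ?_)
    · linarith [h1 p (hprime p (Finset.mem_powerset.mp hQ hp))]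
    · exact h0 p (hprime p (Finset.mem_sdiff.mp hp).1)
  have hfm : ∀ m ∈ s, f m * S m ≤
      ∑ Q ∈ P.powerset, w Q * (selbergForm Q D m ^ 2 * S m) := by
    intro m hm
    have hm1 := (Finset.mem_Icc.mp (hs hm)).1
    have hle := multiplicative_le_prod h0 h1 (by omega) (hf m hm) hprime
    rw [Finset.prod_add] at hle
    calc _ ≤ (∑ Q ∈ P.powerset, (∏ p ∈ Q, if p ∣ m then 0 else 1 - f p) *
          ∏ p ∈ P \ Q, f p) * S m := mul_le_mul_of_nonneg_right hle (by positivity)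
      _ ≤ _ := by
        rw [Finset.sum_mul]
        refine Finset.sum_le_sum fun Q hQ => ?_
        by_cases h : ∃ p ∈ Q, p ∣ m
        · obtain ⟨p, hp, hpm⟩ := h
          rw [Finset.prod_eq_zero hp (by simp [hpm]), zero_mul, zero_mul]
          exact mul_nonneg (hw0 Q hQ) (by positivity)
        · push Not at h
          rw [selbergForm_eq_one hD fun p hp _ => h p hp, hw,
            Finset.prod_congr rfl fun p hp => if_neg (h p hp)]
          simp
  calc _ ≤ ∑ m ∈ s, ∑ Q ∈ P.powerset, w Q * (selbergForm Q D m ^ 2 * S m) :=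
        Finset.sum_le_sum hfm
    _ ≤ ∑ m ∈ Finset.Icc 1 N, ∑ Q ∈ P.powerset, w Q * (selbergForm Q D m ^ 2 * S m) :=
        Finset.sum_le_sum_of_subset_of_nonneg hs fun m _ _ =>
          Finset.sum_nonneg fun Q hQ => mul_nonneg (hw0 Q hQ) (by positivity)
    _ = ∑ Q ∈ P.powerset, w Q * ∑ m ∈ Finset.Icc 1 N, selbergForm Q D m ^ 2 * S m := by
        rw [Finset.sum_comm]
        simp_rw [Finset.mul_sum]
    _ ≤ ∑ Q ∈ P.powerset, w Q * (8 * N / Real.log (D + 1) *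
          ∏ p ∈ P \ Q, (1 - 1 / (p : ℝ))⁻¹ + 12 * (D : ℝ) ^ 6) := by
        refine Finset.sum_le_sum fun Q hQ => mul_le_mul_of_nonneg_left ?_ (hw0 Q hQ)
        refine (sum_selbergForm_sq_mul_norm_sq_le hD Q N D ha).trans ?_
        have hlog' := log_le_selbergSum_mul_prod (Finset.mem_powerset.mp hQ)
        have hS1 := one_le_selbergSum hD Q
        set V := ∏ p ∈ P \ Q, (1 - 1 / (p : ℝ))⁻¹
        have h5 : (N : ℝ) / selbergSum Q D ≤ N / Real.log (D + 1) * V := by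
          rw [div_mul_eq_mul_div, div_le_div_iff₀ (by linarith) hlog]
          calc (N : ℝ) * Real.log (D + 1) ≤ N * (selbergSum Q D * V) := by gcongr
            _ = _ := by ring
        -- The error 8D⁴ + 4D²·D⁴ is at most 12D⁶.
        have h6 : (D : ℝ) ^ 4 ≤ (D : ℝ) ^ 6 := pow_le_pow_right₀ hD1 (by norm_num)
        have h7 : 4 * (D : ℝ) ^ 2 * (D : ℝ) ^ 4 = 4 * (D : ℝ) ^ 6 := by ring
        have h8 : 8 * (N : ℝ) / Real.log (D + 1) * V = 8 * (N / Real.log (D + 1) * V) := by ring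
        rw [h7, h8]
        linarith
    _ = 8 * N / Real.log (D + 1) *
          (∑ Q ∈ P.powerset, w Q * ∏ p ∈ P \ Q, (1 - 1 / (p : ℝ))⁻¹) +
        (∑ Q ∈ P.powerset, w Q) * (12 * (D : ℝ) ^ 6) := by
        rw [Finset.mul_sum, Finset.sum_mul, ← Finset.sum_add_distrib]
        refine Finset.sum_congr rfl fun Q _ => ?_
        ring
    _ = _ := by
        have e1 : ∑ Q ∈ P.powerset, w Q = 1 := by
          rw [← Finset.prod_add]
          simp
        -- By independence the expectation factors, with local factor (1 - f(p)) + f(p)(1 - 1/p)⁻¹.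
        have e2 : ∑ Q ∈ P.powerset, w Q * ∏ p ∈ P \ Q, (1 - 1 / (p : ℝ))⁻¹ =
            ∏ p ∈ P, (1 + f p / (p - 1)) := by
          have : ∀ Q ∈ P.powerset, w Q * ∏ p ∈ P \ Q, (1 - 1 / (p : ℝ))⁻¹ =
              (∏ p ∈ Q, (1 - f p)) * ∏ p ∈ P \ Q, (f p * (1 - 1 / (p : ℝ))⁻¹) := by
            intro Q _
            rw [Finset.prod_mul_distrib, hw]
            ring
          rw [Finset.sum_congr rfl this, ← Finset.prod_add]
          refine Finset.prod_congr rfl fun p hp => ?_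
          have hp1 : (1 : ℝ) < p := by exact_mod_cast (hprime p hp).one_lt
          have : (p : ℝ) - 1 ≠ 0 := by linarith
          have : (p : ℝ) ≠ 0 := by linarith
          have : 1 - 1 / (p : ℝ) ≠ 0 := by
            have : 1 / (p : ℝ) < 1 := by rw [div_lt_one (by linarith)]; exact hp1
            linarith
          field_simp
          ring
        rw [e1, e2, one_mul]

/-! ### Abel summation and moments of the divisor function. -/

theorem sum_Ioc_mul_eq_abel (g : ℕ → ℂ) (w : ℕ → ℝ) (A k : ℕ) :
    ∑ n ∈ Finset.Ioc A (A + k), (w n : ℂ) * g n =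
      w (A + k + 1) * ∑ n ∈ Finset.Ioc A (A + k), g n +
        ∑ n ∈ Finset.Ioc A (A + k), ((w n - w (n + 1) : ℝ) : ℂ) * ∑ i ∈ Finset.Ioc A n, g i := by
  induction k with
  | zero => simp
  | succ k ih =>
    rw [← add_assoc, Finset.sum_Ioc_succ_top (by omega), Finset.sum_Ioc_succ_top (by omega),
      Finset.sum_Ioc_succ_top (by omega), ih, Finset.sum_Ioc_succ_top (by omega)]
    push_cast
    ring

theorem norm_sum_Ioc_mul_le {g : ℕ → ℂ} {w : ℕ → ℝ} {A : ℕ} {M : ℝ}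
    (hg : ∀ B, ‖∑ n ∈ Finset.Ioc A B, g n‖ ≤ M) (hw0 : ∀ n, A < n → 0 ≤ w n)
    (hw : ∀ n, A < n → w (n + 1) ≤ w n) (B : ℕ) :
    ‖∑ n ∈ Finset.Ioc A B, (w n : ℂ) * g n‖ ≤ M * w (A + 1) := by
  have hM : 0 ≤ M := (norm_nonneg _).trans (hg A)
  rcases lt_or_ge B A with h | h
  · rw [Finset.Ioc_eq_empty (by omega)]
    simpa using mul_nonneg hM (hw0 (A + 1) (by omega))
  obtain ⟨k, rfl⟩ := Nat.exists_eq_add_of_le h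
  have tel : ∀ k, ∑ n ∈ Finset.Ioc A (A + k), (w n - w (n + 1)) = w (A + 1) - w (A + k + 1) := by
    intro k
    induction k with
    | zero => simp
    | succ k ih =>
      rw [← add_assoc, Finset.sum_Ioc_succ_top (by omega), ih]
      ring
  rw [sum_Ioc_mul_eq_abel]
  calc _ ≤ w (A + k + 1) * M + ∑ n ∈ Finset.Ioc A (A + k), (w n - w (n + 1)) * M := by
        refine (norm_add_le _ _).trans (add_le_add ?_ ?_)
        · rw [norm_mul, Complex.norm_real, Real.norm_of_nonneg (hw0 _ (by omega))]
          exact mul_le_mul_of_nonneg_left (hg _) (hw0 _ (by omega))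
        · refine (norm_sum_le _ _).trans (Finset.sum_le_sum fun n hn => ?_)
          have h1 := hw n (Finset.mem_Ioc.mp hn).1
          rw [norm_mul, Complex.norm_real, Real.norm_of_nonneg (by linarith)]
          exact mul_le_mul_of_nonneg_left (hg _) (by linarith)
    _ = _ := by rw [← Finset.sum_mul, tel]; ring

theorem norm_sum_Ioc_div_le {g : ℕ → ℂ} {A : ℕ} {M : ℝ}
    (hg : ∀ B, ‖∑ n ∈ Finset.Ioc A B, g n‖ ≤ M) (B : ℕ) :
    ‖∑ n ∈ Finset.Ioc A B, g n / n‖ ≤ M / (A + 1) := by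
  have h := norm_sum_Ioc_mul_le (w := fun n => 1 / (n : ℝ)) hg (fun n _ => by positivity)
    (fun n hn => one_div_le_one_div_of_le (by
      have : 0 < n := by omega
      exact_mod_cast this) (by push_cast; linarith)) B
  have e : ∀ n, g n / n = ((1 / (n : ℝ) : ℝ) : ℂ) * g n := by
    intro n; push_cast; ring
  simp_rw [e]
  refine h.trans (le_of_eq ?_)
  push_cast
  ring

theorem card_divisors_mul_le (a b : ℕ) :
    (a * b).divisors.card ≤ a.divisors.card * b.divisors.card := by
  rw [Nat.divisors_mul]
  exact Finset.card_mul_le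

theorem sum_one_div_le_log (x : ℕ) :
    ∑ n ∈ Finset.Icc 1 x, 1 / (n : ℝ) ≤ 1 + Real.log x := by
  have := harmonic_le_one_add_log x
  rw [harmonic_eq_sum_Icc] at this
  push_cast at this
  simpa [one_div] using this

/-- One factor τ(n) is opened as a sum over a ∣ n with n = ak. Since τ(ak) ≤ τ(a)τ(k), the sum for r
+ 1 is at most the square of the sum for r. -/
theorem sum_card_divisors_pow_div_le (r x : ℕ) :
    ∑ n ∈ Finset.Icc 1 x, (n.divisors.card : ℝ) ^ r / n ≤ (1 + Real.log x) ^ (2 ^ r) := by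
  induction r with
  | zero => simpa using sum_one_div_le_log x
  | succ r ih =>
    have h0 : 0 ≤ ∑ n ∈ Finset.Icc 1 x, (n.divisors.card : ℝ) ^ r / n :=
      Finset.sum_nonneg fun _ _ => by positivity
    have e : ∀ n ∈ Finset.Icc 1 x, (n.divisors.card : ℝ) ^ (r + 1) / n =
        ∑ a ∈ Finset.Icc 1 x, if a ∣ n then (n.divisors.card : ℝ) ^ r / n else 0 := by
      intro n hn
      have hn' := Finset.mem_Icc.mp hn
      have : (Finset.Icc 1 x).filter (· ∣ n) = n.divisors := by
        ext a
        simp only [Finset.mem_filter, Finset.mem_Icc, Nat.mem_divisors]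
        constructor
        · rintro ⟨-, h⟩; exact ⟨h, by omega⟩
        · rintro ⟨h, -⟩
          exact ⟨⟨Nat.pos_of_dvd_of_pos h (by omega), (Nat.le_of_dvd (by omega) h).trans hn'.2⟩, h⟩
      rw [← Finset.sum_filter, this, Finset.sum_const, nsmul_eq_mul]
      ring
    rw [Finset.sum_congr rfl e, Finset.sum_comm]
    calc _ ≤ ∑ a ∈ Finset.Icc 1 x, ∑ k ∈ Finset.Icc 1 x,
          (a.divisors.card : ℝ) ^ r / a * ((k.divisors.card : ℝ) ^ r / k) := by
          refine Finset.sum_le_sum fun a ha => ?_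
          have ha' := Finset.mem_Icc.mp ha
          rw [← Finset.sum_filter, sum_dvd_Icc (by omega)]
          refine (Finset.sum_le_sum_of_subset_of_nonneg
            (Finset.Icc_subset_Icc_right (Nat.div_le_self x a)) fun _ _ _ => by positivity).trans
            (Finset.sum_le_sum fun k _ => ?_)
          rw [div_mul_div_comm, ← mul_pow]
          push_cast
          gcongr
          exact_mod_cast card_divisors_mul_le a k
      _ = (∑ n ∈ Finset.Icc 1 x, (n.divisors.card : ℝ) ^ r / n) ^ 2 := by
          rw [sq, Finset.sum_mul_sum]
      _ ≤ ((1 + Real.log x) ^ (2 ^ r)) ^ 2 := by gcongr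
      _ = _ := by rw [← pow_mul, pow_succ]

/-! ### High moments of the tail through a bilinear estimate. -/

theorem not_isSquare_mul_of_squarefree {a b : ℕ} (ha : Squarefree a) (hb : Squarefree b)
    (hab : a ≠ b) : ¬ IsSquare (a * b) := by
  intro h
  obtain ⟨g, u, v, rfl, rfl⟩ := exists_eq_mul_sq_of_isSquare_mul ha.ne_zero h
  have hu : u = 1 := Nat.isUnit_iff.mp (ha u ⟨g, by ring⟩)
  have hv : v = 1 := Nat.isUnit_iff.mp (hb v ⟨g, by ring⟩)
  exact hab (by rw [hu, hv])

theorem exists_unimodular_pow (z : ℂ) {j : ℕ} (hj : j ≠ 0) :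
    ∃ c : ℂ, ‖c‖ ≤ 1 ∧ ((‖z‖ ^ j : ℝ) : ℂ) = c * z ^ j := by
  by_cases hz : z = 0
  · exact ⟨0, by simp, by simp [hz, hj]⟩
  · refine ⟨((‖z‖ ^ j : ℝ) : ℂ) / z ^ j, ?_, ?_⟩
    · rw [norm_div, Complex.norm_real, norm_pow, norm_pow, norm_norm, div_self]
      exact pow_ne_zero _ (norm_ne_zero_iff.mpr hz)
    · rw [div_mul_cancel₀]
      exact pow_ne_zero _ hz

/-- On opening the square, each m = m' costs a harmonic sum. For m ≠ m' the product is a nonsquare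
with period at most N², and since n > Y ≥ N³ - 1 Abel summation gives at most 1/N for each of the N²
pairs. -/
theorem sum_norm_sq_bilinear_le {s : Finset ℕ} {N : ℕ} (hs : s ⊆ Finset.Icc 1 N)
    (hodd : ∀ m ∈ s, Odd m) (hsq : ∀ m ∈ s, Squarefree m) {c : ℕ → ℂ}
    (hc : ∀ m ∈ s, ‖c m‖ ≤ 1) {Y : ℕ} (hY : N ^ 3 ≤ Y + 1) (W : ℕ) :
    ∑ n ∈ Finset.Ioc Y W, ‖∑ m ∈ s, c m * oddJacobi n m‖ ^ 2 / n ≤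
      N * (2 + Real.log W) := by
  have h1 : ((∑ n ∈ Finset.Ioc Y W, ‖∑ m ∈ s, c m * oddJacobi n m‖ ^ 2 / n : ℝ) : ℂ) =
      ∑ m ∈ s, ∑ m' ∈ s, c m * (starRingEnd ℂ) (c m') *
        ((∑ n ∈ Finset.Ioc Y W, oddJacobi n (m * m') / n : ℝ) : ℂ) := by
    rw [Complex.ofReal_sum]
    have : ∀ n ∈ Finset.Ioc Y W, ((‖∑ m ∈ s, c m * oddJacobi n m‖ ^ 2 / n : ℝ) : ℂ) =
        ∑ m ∈ s, ∑ m' ∈ s, c m * (starRingEnd ℂ) (c m') *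
          ((oddJacobi n (m * m') / n : ℝ) : ℂ) := by
      intro n _
      push_cast
      rw [← Complex.mul_conj', map_sum, Finset.sum_mul_sum, Finset.sum_div]
      refine Finset.sum_congr rfl fun m _ => ?_
      rw [Finset.sum_div]
      refine Finset.sum_congr rfl fun m' _ => ?_
      rw [map_mul, Complex.conj_ofReal, oddJacobi_mul_right]
      push_cast
      ring
    rw [Finset.sum_congr rfl this, Finset.sum_comm]
    refine Finset.sum_congr rfl fun m _ => ?_
    rw [Finset.sum_comm]
    refine Finset.sum_congr rfl fun m' _ => ?_
    rw [← Finset.mul_sum, Complex.ofReal_sum]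
  have h2 : ∑ n ∈ Finset.Ioc Y W, ‖∑ m ∈ s, c m * oddJacobi n m‖ ^ 2 / n =
      ‖((∑ n ∈ Finset.Ioc Y W, ‖∑ m ∈ s, c m * oddJacobi n m‖ ^ 2 / n : ℝ) : ℂ)‖ := by
    rw [Complex.norm_real, Real.norm_of_nonneg (Finset.sum_nonneg fun _ _ => by positivity)]
  have hlogW : 0 ≤ 1 + Real.log W := by
    have := Real.log_natCast_nonneg W
    linarith
  have h3 : ∀ m ∈ s, ∀ m' ∈ s, |∑ n ∈ Finset.Ioc Y W, oddJacobi n (m * m') / n| ≤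
      (if m = m' then 1 + Real.log W else 0) + 1 / N := by
    intro m hm m' hm'
    have hm1 := Finset.mem_Icc.mp (hs hm)
    have hm1' := Finset.mem_Icc.mp (hs hm')
    have hN : (0 : ℝ) < N := by
      have : 0 < N := by omega
      exact_mod_cast this
    split_ifs with h
    · refine le_trans ?_ (le_add_of_nonneg_right (by positivity))
      refine le_trans ?_ (sum_one_div_le_log W)
      refine (Finset.abs_sum_le_sum_abs _ _).trans ?_
      calc _ ≤ ∑ n ∈ Finset.Ioc Y W, 1 / (n : ℝ) := by
            refine Finset.sum_le_sum fun n _ => ?_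
            rw [abs_div, Nat.abs_cast]
            gcongr
            exact abs_oddJacobi_le _ _
        _ ≤ _ := Finset.sum_le_sum_of_subset_of_nonneg (fun n hn => by
            simp only [Finset.mem_Ioc, Finset.mem_Icc] at hn ⊢; omega) fun _ _ _ => by positivity
    · rw [zero_add]
      have hk := fun B => abs_sum_oddJacobi_left_le ((hodd m hm).mul (hodd m' hm'))
        (not_isSquare_mul_of_squarefree (hsq m hm) (hsq m' hm') h) Y B
      have := norm_sum_Ioc_div_le (g := fun n => (oddJacobi n (m * m') : ℂ)) (A := Y)
        (M := (m * m' : ℕ)) (fun B => by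
          rw [← Complex.ofReal_sum, Complex.norm_real]; exact hk B) W
      have e : ∑ n ∈ Finset.Ioc Y W, ((oddJacobi n (m * m') : ℝ) : ℂ) / n =
          ((∑ n ∈ Finset.Ioc Y W, oddJacobi n (m * m') / n : ℝ) : ℂ) := by
        push_cast; rfl
      rw [e, Complex.norm_real, Real.norm_eq_abs] at this
      refine this.trans ?_
      rw [div_le_div_iff₀ (by positivity) hN, one_mul]
      have h5 : m * m' * N ≤ Y + 1 := by
        refine le_trans ?_ hY
        calc m * m' * N ≤ N * N * N := by gcongr <;> omega
          _ = _ := by ring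
      exact_mod_cast h5
  have hcard : (s.card : ℝ) ≤ N := by
    have := Finset.card_le_card hs
    simp only [Nat.card_Icc, Nat.add_sub_cancel] at this
    exact_mod_cast this
  rw [h2, h1]
  calc _ ≤ ∑ m ∈ s, ∑ m' ∈ s, ((if m = m' then 1 + Real.log W else 0) + 1 / (N : ℝ)) := by
        refine (norm_sum_le _ _).trans (Finset.sum_le_sum fun m hm => ?_)
        refine (norm_sum_le _ _).trans (Finset.sum_le_sum fun m' hm' => ?_)
        rw [norm_mul, norm_mul, RCLike.norm_conj, Complex.norm_real, Real.norm_eq_abs]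
        calc _ ≤ 1 * |∑ n ∈ Finset.Ioc Y W, oddJacobi n (m * m') / n| := by
              gcongr
              exact mul_le_one₀ (hc m hm) (norm_nonneg _) (hc m' hm')
          _ ≤ _ := by rw [one_mul]; exact h3 m hm m' hm'
    _ = s.card * (1 + Real.log W) + s.card * (s.card * (1 / (N : ℝ))) := by
        simp_rw [Finset.sum_add_distrib, Finset.sum_ite_eq]
        rw [Finset.sum_ite_mem, Finset.inter_self]
        simp only [Finset.sum_const, nsmul_eq_mul]
    _ ≤ N * (1 + Real.log W) + N * 1 := by
        refine add_le_add (mul_le_mul_of_nonneg_right hcard hlogW)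
          (mul_le_mul hcard ?_
            (mul_nonneg (Nat.cast_nonneg _) (one_div_nonneg.mpr (Nat.cast_nonneg _)))
            (Nat.cast_nonneg _))
        rcases Nat.eq_zero_or_pos N with hN | hN
        · rw [hN, Nat.cast_zero, div_zero, mul_zero]; exact zero_le_one
        · have : (0 : ℝ) < N := by exact_mod_cast hN
          rw [mul_one_div, div_le_one this]; exact hcard
    _ = _ := by ring

theorem card_tuples_prod_eq_le (j n : ℕ) (hn : n ≠ 0) (I : Finset ℕ) :
    ((Fintype.piFinset fun _ : Fin j => I).filter fun t => ∏ i, t i = n).card ≤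
      n.divisors.card ^ j := by
  have : (Fintype.piFinset fun _ : Fin j => I).filter (fun t => ∏ i, t i = n) ⊆
      Fintype.piFinset fun _ : Fin j => n.divisors := by
    intro t ht
    rw [Finset.mem_filter] at ht
    refine Fintype.mem_piFinset.mpr fun i => Nat.mem_divisors.mpr ⟨?_, hn⟩
    rw [← ht.2]
    exact Finset.dvd_prod_of_mem _ (Finset.mem_univ i)
  exact (Finset.card_le_card this).trans (by simp)

theorem oddJacobi_prod {ι : Type*} (u : Finset ι) (t : ι → ℕ) {m : ℕ} (hm : Odd m) :
    oddJacobi (∏ i ∈ u, t i) m = ∏ i ∈ u, oddJacobi (t i) m := by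
  classical
  induction u using Finset.induction_on with
  | empty => simpa using oddJacobi_one_left m hm
  | insert i u hi ih => rw [Finset.prod_insert hi, Finset.prod_insert hi, oddJacobi_mul_left, ih]

/-- Unimodular phases `c m` replace |S|^j by S^j, a sum over products of `j` integers whose
coefficients are controlled by τ(n)^j/n. Cauchy–Schwarz in `n` then separates the divisor moment
from the bilinear form. The power `j` serves to make the variable `n` exceed N³. -/
theorem sum_norm_pow_jacobiSum₁_le {s : Finset ℕ} {N : ℕ} (hs : s ⊆ Finset.Icc 1 N)
    (hodd : ∀ m ∈ s, Odd m) (hsq : ∀ m ∈ s, Squarefree m) {a : ℕ → ℂ} (ha : ∀ n, ‖a n‖ ≤ 1)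
    {j y : ℕ} (hj : j ≠ 0) (hy : N ^ 3 ≤ (y + 1) ^ j) (Z : ℕ) :
    (∑ m ∈ s, ‖jacobiSum₁ a (Finset.Ioc y Z) m‖ ^ j) ^ 2 ≤
      (1 + Real.log (Z ^ j : ℕ)) ^ (2 ^ (j * 2)) * (N * (2 + Real.log (Z ^ j : ℕ))) := by
  set I := Finset.Ioc y Z with hI
  choose c hc1 hc2 using fun m => exists_unimodular_pow (jacobiSum₁ a I m) hj
  set G : ℕ → ℝ := fun n => ‖∑ m ∈ s, c m * oddJacobi n m‖ with hG
  -- A product of `j` integers exceeding `y` is at least (y+1)^j, and the interval `Ioc` is open on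
  -- the left.
  set Y := (y + 1) ^ j - 1 with hYdef
  have hY1 : Y + 1 = (y + 1) ^ j := Nat.sub_add_cancel (Nat.one_le_pow _ _ (by omega))
  have hmaps : ∀ t ∈ Fintype.piFinset fun _ : Fin j => I,
      ∏ i, t i ∈ Finset.Ioc Y (Z ^ j) := by
    intro t ht
    rw [Fintype.mem_piFinset] at ht
    have h1 : (y + 1) ^ j ≤ ∏ i, t i := by
      calc (y + 1) ^ j = ∏ _i : Fin j, (y + 1) := by simp
        _ ≤ _ := Finset.prod_le_prod' fun i _ => (Finset.mem_Ioc.mp (ht i)).1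
    have h2 : ∏ i, t i ≤ Z ^ j := by
      calc _ ≤ ∏ _i : Fin j, Z := Finset.prod_le_prod' fun i _ => (Finset.mem_Ioc.mp (ht i)).2
        _ = _ := by simp
    rw [Finset.mem_Ioc]
    omega
  have hpow : ∀ m ∈ s, jacobiSum₁ a I m ^ j = ∑ t ∈ Fintype.piFinset fun _ : Fin j => I,
      (∏ i, a (t i) / (t i)) * oddJacobi (∏ i, t i) m := by
    intro m hm
    rw [jacobiSum₁, Finset.sum_pow']
    refine Finset.sum_congr rfl fun t _ => ?_
    rw [Finset.prod_mul_distrib, oddJacobi_prod _ _ (hodd m hm)]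
    push_cast
    rfl
  have h1 : ∑ m ∈ s, ‖jacobiSum₁ a I m‖ ^ j ≤
      ∑ n ∈ Finset.Ioc Y (Z ^ j), (n.divisors.card : ℝ) ^ j / n * G n := by
    have e1 : ((∑ m ∈ s, ‖jacobiSum₁ a I m‖ ^ j : ℝ) : ℂ) =
        ∑ t ∈ Fintype.piFinset fun _ : Fin j => I, (∏ i, a (t i) / (t i)) *
          ∑ m ∈ s, c m * oddJacobi (∏ i, t i) m := by
      rw [Complex.ofReal_sum, Finset.sum_congr rfl fun m hm => (hc2 m).trans
        (by rw [hpow m hm, Finset.mul_sum]), Finset.sum_comm]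
      refine Finset.sum_congr rfl fun t _ => ?_
      rw [Finset.mul_sum]
      refine Finset.sum_congr rfl fun m _ => ?_
      ring
    have e2 : ∑ m ∈ s, ‖jacobiSum₁ a I m‖ ^ j =
        ‖((∑ m ∈ s, ‖jacobiSum₁ a I m‖ ^ j : ℝ) : ℂ)‖ := by
      rw [Complex.norm_real, Real.norm_of_nonneg (Finset.sum_nonneg fun _ _ => by positivity)]
    rw [e2, e1]
    calc _ ≤ ∑ t ∈ Fintype.piFinset fun _ : Fin j => I,
          1 / ((∏ i, t i : ℕ) : ℝ) * G (∏ i, t i) := by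
          refine (norm_sum_le _ _).trans (Finset.sum_le_sum fun t _ => ?_)
          rw [norm_mul, norm_prod]
          refine mul_le_mul_of_nonneg_right ?_ (norm_nonneg _)
          push_cast
          rw [one_div, ← Finset.prod_inv_distrib]
          refine Finset.prod_le_prod (fun _ _ => norm_nonneg _) fun i _ => ?_
          rw [norm_div, Complex.norm_natCast, div_eq_mul_inv]
          exact mul_le_of_le_one_left (by positivity) (ha _)
      _ = ∑ n ∈ Finset.Ioc Y (Z ^ j), ∑ t ∈ (Fintype.piFinset fun _ : Fin j => I).filter
            fun t => ∏ i, t i = n, 1 / ((∏ i, t i : ℕ) : ℝ) * G (∏ i, t i) :=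
          (Finset.sum_fiberwise_of_maps_to hmaps _).symm
      _ ≤ _ := by
          refine Finset.sum_le_sum fun n hn => ?_
          have hn0 : n ≠ 0 := by
            have := (Finset.mem_Ioc.mp hn).1
            omega
          rw [Finset.sum_congr rfl fun t ht => by rw [(Finset.mem_filter.mp ht).2],
            Finset.sum_const, nsmul_eq_mul, ← mul_assoc, mul_one_div]
          refine mul_le_mul_of_nonneg_right ?_ (norm_nonneg _)
          gcongr
          exact_mod_cast card_tuples_prod_eq_le j n hn0 I
  have h2 : (∑ n ∈ Finset.Ioc Y (Z ^ j), (n.divisors.card : ℝ) ^ j / n * G n) ^ 2 ≤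
      (∑ n ∈ Finset.Ioc Y (Z ^ j), (n.divisors.card : ℝ) ^ (j * 2) / n) *
        ∑ n ∈ Finset.Ioc Y (Z ^ j), G n ^ 2 / n := by
    refine Finset.sum_sq_le_sum_mul_sum_of_sq_le_mul _ (fun _ _ => by positivity)
      (fun _ _ => by positivity) fun n _ => le_of_eq ?_
    rw [pow_mul]
    ring
  have h3 := sum_norm_sq_bilinear_le hs hodd hsq (c := c) (fun m _ => hc1 m) (Y := Y)
    (by rw [hY1]; exact hy) (Z ^ j)
  have h4 : ∑ n ∈ Finset.Ioc Y (Z ^ j), (n.divisors.card : ℝ) ^ (j * 2) / n ≤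
      (1 + Real.log (Z ^ j : ℕ)) ^ (2 ^ (j * 2)) :=
    (Finset.sum_le_sum_of_subset_of_nonneg (fun n hn => by
      simp only [Finset.mem_Ioc, Finset.mem_Icc] at hn ⊢; omega)
      fun _ _ _ => by positivity).trans (sum_card_divisors_pow_div_le (j * 2) (Z ^ j))
  have hlog := Real.log_natCast_nonneg (Z ^ j)
  calc _ ≤ (∑ n ∈ Finset.Ioc Y (Z ^ j), (n.divisors.card : ℝ) ^ j / n * G n) ^ 2 := by
        gcongr
    _ ≤ _ := h2
    _ ≤ _ := mul_le_mul h4 h3 (Finset.sum_nonneg fun _ _ => by positivity) (by positivity)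

/-! ### Approximating L(1, χ) by a partial sum. -/

open Filter Topology in
theorem norm_LOne_sub_sum_le {N : ℕ} (hN : N ≠ 0) {χ : DirichletCharacter ℂ N} (hχ : χ ≠ 1)
    (Z : ℕ) : ‖LOne χ - ∑ n ∈ Finset.Ioc 0 Z, χ (n : ZMod N) / n‖ ≤ N / (Z + 1) := by
  have : NeZero N := ⟨hN⟩
  have hL : LOne χ = DirichletCharacter.LFunction χ 1 := by
    rw [LOne, dif_neg hN]
  -- The bound is uniform in real s > 1, where the series converges absolutely, so it passes to s →
  -- 1⁺ by continuity of the L-function.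
  have key : ∀ s : ℝ, 1 < s → ‖DirichletCharacter.LFunction χ s -
      ∑ n ∈ Finset.Ioc 0 Z, χ (n : ZMod N) / (n : ℂ) ^ (s : ℂ)‖ ≤ N / (Z + 1) := by
    intro s hs
    have hs' : 1 < (s : ℂ).re := by simpa using hs
    rw [DirichletCharacter.LFunction_eq_LSeries χ hs']
    have hsum := (χ.LSeriesSummable_of_one_lt_re hs').LSeriesHasSum.tendsto_sum_nat
    have hsum' := (hsum.comp (tendsto_add_atTop_nat 1)).sub_const
      (∑ n ∈ Finset.Ioc 0 Z, χ (n : ZMod N) / (n : ℂ) ^ (s : ℂ))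
    refine le_of_tendsto hsum'.norm ?_
    filter_upwards [eventually_ge_atTop Z] with B hB
    have e1 : ∑ n ∈ Finset.range (B + 1), LSeries.term (fun n => χ (n : ZMod N)) s n =
        ∑ n ∈ Finset.Ioc 0 B, χ (n : ZMod N) / (n : ℂ) ^ (s : ℂ) := by
      rw [Finset.range_eq_Ico, Finset.sum_eq_sum_Ico_succ_bot (by omega)]
      rw [LSeries.term_zero, zero_add]
      have : Finset.Ico (0 + 1) (B + 1) = Finset.Ioc 0 B := by
        ext x; simp only [Finset.mem_Ico, Finset.mem_Ioc]; omega
      rw [this]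
      refine Finset.sum_congr rfl fun n hn => ?_
      have := (Finset.mem_Ioc.mp hn).1
      rw [LSeries.term_of_ne_zero (by omega)]
    have e2 : ∑ n ∈ Finset.Ioc 0 B, χ (n : ZMod N) / (n : ℂ) ^ (s : ℂ) -
        ∑ n ∈ Finset.Ioc 0 Z, χ (n : ZMod N) / (n : ℂ) ^ (s : ℂ) =
        ∑ n ∈ Finset.Ioc Z B, (((((n : ℝ) ^ s)⁻¹ : ℝ)) : ℂ) * χ (n : ZMod N) := by
      have h1 : ∀ n : ℕ, (((((n : ℝ) ^ s)⁻¹ : ℝ)) : ℂ) * χ (n : ZMod N) =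
          χ (n : ZMod N) / (n : ℂ) ^ (s : ℂ) := by
        intro n
        rw [Complex.ofReal_inv, Complex.ofReal_cpow (Nat.cast_nonneg n), Complex.ofReal_natCast,
          div_eq_mul_inv, mul_comm]
      simp_rw [h1]
      rw [sub_eq_iff_eq_add, add_comm, ← Finset.sum_union]
      · rw [Finset.Ioc_union_Ioc_eq_Ioc (by omega) hB]
      · rw [Finset.disjoint_left]
        intro x hx hx'
        simp only [Finset.mem_Ioc] at hx hx'
        omega
    simp only [Function.comp_apply]
    rw [e1, e2]
    refine (norm_sum_Ioc_mul_le (w := fun n => ((n : ℝ) ^ s)⁻¹)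
      (fun B => norm_sum_Ioc_le_of_ne_one hχ Z B) (fun n _ => by positivity) (fun n hn => ?_)
      B).trans ?_
    · have : (0 : ℝ) < n := by
        have : 0 < n := by omega
        exact_mod_cast this
      refine inv_anti₀ (by positivity) ?_
      exact Real.rpow_le_rpow this.le (by push_cast; linarith) (by linarith)
    · rw [div_eq_mul_inv]
      gcongr
      push_cast
      have h1 : (1 : ℝ) ≤ (Z : ℝ) + 1 := by linarith [Nat.cast_nonneg (α := ℝ) Z]
      calc (Z : ℝ) + 1 = ((Z : ℝ) + 1) ^ (1 : ℝ) := (Real.rpow_one _).symm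
        _ ≤ _ := Real.rpow_le_rpow_of_exponent_le h1 hs.le
  have hcont : Tendsto (fun s : ℝ => DirichletCharacter.LFunction χ s -
      ∑ n ∈ Finset.Ioc 0 Z, χ (n : ZMod N) / (n : ℂ) ^ (s : ℂ)) (𝓝[>] 1)
      (𝓝 (DirichletCharacter.LFunction χ 1 - ∑ n ∈ Finset.Ioc 0 Z, χ (n : ZMod N) / n)) := by
    have hof : Tendsto (fun s : ℝ => (s : ℂ)) (𝓝[>] 1) (𝓝 1) := by
      have := (Complex.continuous_ofReal.tendsto (1 : ℝ)).mono_left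
        (nhdsWithin_le_nhds (s := Set.Ioi 1))
      simpa using this
    refine Tendsto.sub ?_ (tendsto_finsetSum _ fun n hn => ?_)
    · exact (DirichletCharacter.differentiable_LFunction hχ).continuous.continuousAt.tendsto.comp hof
    · have hn0 : (n : ℂ) ≠ 0 := by
        have := (Finset.mem_Ioc.mp hn).1
        exact_mod_cast this.ne'
      have h := (continuousAt_const_cpow (b := (1 : ℂ)) hn0).tendsto.comp hof
      rw [Complex.cpow_one] at h
      exact tendsto_const_nhds.div h hn0
  rw [hL]
  refine le_of_tendsto hcont.norm ?_
  filter_upwards [self_mem_nhdsWithin] with s hs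
  exact key s hs

/-! ### Mertens' upper bounds for sums over primes. -/

theorem sum_log_prime_div_le {n : ℕ} (hn : 1 ≤ n) :
    ∑ p ∈ (Finset.Icc 1 n).filter Nat.Prime, Real.log p / p ≤ Real.log n + Real.log 4 := by
  set P := (Finset.Icc 1 n).filter Nat.Prime with hP
  have hprime : ∀ p ∈ P, p.Prime := fun p hp => (Finset.mem_filter.mp hp).2
  have hn0 : (0 : ℝ) < n := by exact_mod_cast hn
  -- The left side is the sum over m ≤ n of the logarithm of the radical of `m`.
  have h1 : ∑ p ∈ P, ((n / p : ℕ) : ℝ) * Real.log p ≤ n * Real.log n := by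
    have e : ∀ p ∈ P, ((n / p : ℕ) : ℝ) * Real.log p =
        ∑ m ∈ Finset.Icc 1 n, if p ∣ m then Real.log p else 0 := by
      intro p hp
      rw [← Finset.sum_filter, sum_dvd_Icc (hprime p hp).pos]
      simp
    rw [Finset.sum_congr rfl e, Finset.sum_comm]
    calc _ ≤ ∑ m ∈ Finset.Icc 1 n, Real.log n := by
          refine Finset.sum_le_sum fun m hm => ?_
          have hm' := Finset.mem_Icc.mp hm
          have hset : P.filter (· ∣ m) = m.primeFactors := by
            ext p
            simp only [hP, Finset.mem_filter, Finset.mem_Icc, Nat.mem_primeFactors]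
            constructor
            · rintro ⟨⟨-, a⟩, b⟩; exact ⟨a, b, by omega⟩
            · rintro ⟨a, b, -⟩
              exact ⟨⟨⟨a.one_le, (Nat.le_of_dvd (by omega) b).trans hm'.2⟩, a⟩, b⟩
          rw [← Finset.sum_filter, hset, ← Real.log_prod fun p hp => by
            have := (Nat.prime_of_mem_primeFactors hp).pos
            positivity]
          have h2 : ∏ p ∈ m.primeFactors, p ≤ n :=
            (Nat.le_of_dvd (by omega) (Nat.prod_primeFactors_dvd m)).trans hm'.2
          have h3 : 0 < ∏ p ∈ m.primeFactors, p :=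
            Finset.prod_pos fun p hp => (Nat.prime_of_mem_primeFactors hp).pos
          rw [← Nat.cast_prod]
          refine Real.log_le_log ?_ ?_
          · exact_mod_cast h3
          · exact_mod_cast h2
      _ = _ := by simp
  have h2 : ∑ p ∈ P, Real.log p ≤ Real.log 4 * n := by
    have := Chebyshev.theta_le_log4_mul_x (x := n) hn0.le
    rw [Chebyshev.theta_eq_sum_Icc, Nat.floor_natCast] at this
    refine le_trans (Finset.sum_le_sum_of_subset_of_nonneg ?_ fun p hp _ => ?_) this
    · intro p hp
      simp only [hP, Finset.mem_filter, Finset.mem_Icc] at hp ⊢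
      exact ⟨⟨Nat.zero_le _, hp.1.2⟩, hp.2⟩
    · exact Real.log_natCast_nonneg p
  have h3 : n * ∑ p ∈ P, Real.log p / p ≤ ∑ p ∈ P, ((n / p : ℕ) : ℝ) * Real.log p +
      ∑ p ∈ P, Real.log p := by
    rw [Finset.mul_sum, ← Finset.sum_add_distrib]
    refine Finset.sum_le_sum fun p hp => ?_
    have hp0 : (0 : ℝ) < p := by exact_mod_cast (hprime p hp).pos
    have h4 : (n : ℝ) / p ≤ ((n / p : ℕ) : ℝ) + 1 := by
      rw [div_le_iff₀ hp0]
      have := Nat.lt_div_mul_add (a := n) (hprime p hp).pos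
      have h' : (n : ℝ) ≤ ((n / p * p + p : ℕ) : ℝ) := by exact_mod_cast this.le
      push_cast at h' ⊢
      linarith
    calc (n : ℝ) * (Real.log p / p) = n / p * Real.log p := by ring
      _ ≤ (((n / p : ℕ) : ℝ) + 1) * Real.log p := by
          gcongr
      _ = _ := by ring
  have h5 : n * ∑ p ∈ P, Real.log p / p ≤ n * (Real.log n + Real.log 4) := by linarith
  exact le_of_mul_le_mul_left h5 hn0

theorem sum_one_div_prime_le : ∃ C : ℝ, ∀ N : ℕ, 2 ≤ N →
    ∑ p ∈ (Finset.Icc 1 N).filter Nat.Prime, 1 / (p : ℝ) ≤ Real.log (Real.log N) + C := by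
  set c := Real.log 4
  -- Chosen so that both sides of `key` vanish at N = 2.
  set K := -Real.log (Real.log 2) + c / Real.log 2
  refine ⟨K + 1, fun N hN => ?_⟩
  have key : ∀ N : ℕ, 2 ≤ N → ∑ p ∈ (Finset.Icc 1 N).filter Nat.Prime, 1 / (p : ℝ) -
      (∑ p ∈ (Finset.Icc 1 N).filter Nat.Prime, Real.log p / p) / Real.log N ≤
      Real.log (Real.log N) - c / Real.log N + K := by
    intro N hN
    induction N, hN using Nat.le_induction with
    | base =>
      have : (Finset.Icc 1 2).filter Nat.Prime = {2} := by decide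
      rw [this]
      have h2 : Real.log 2 ≠ 0 := (Real.log_pos (by norm_num)).ne'
      simp only [Finset.sum_singleton, Nat.cast_ofNat, K]
      field_simp
      ring_nf
      rfl
    | succ n hn ih =>
      have hn2 : (2 : ℝ) ≤ n := by exact_mod_cast hn
      have hl : 0 < Real.log n := Real.log_pos (by linarith)
      have hl' : Real.log n ≤ Real.log (n + 1 : ℕ) :=
        Real.log_le_log (by linarith) (by push_cast; linarith)
      have hA := sum_log_prime_div_le (n := n) (by omega)
      set A := ∑ p ∈ (Finset.Icc 1 n).filter Nat.Prime, Real.log p / p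
      set R := ∑ p ∈ (Finset.Icc 1 n).filter Nat.Prime, 1 / (p : ℝ)
      set u := Real.log n
      set v := Real.log (n + 1 : ℕ) with hv
      have hv0 : 0 < v := hl.trans_le hl'
      have hlog : 1 - u / v ≤ Real.log v - Real.log u := by
        have := Real.one_sub_inv_le_log_of_pos (div_pos hv0 hl)
        rwa [inv_div, Real.log_div hv0.ne' hl.ne'] at this
      -- A new prime p = n + 1 adds 1/p to both sums, because `v` is its logarithm. Only the change
      -- of the weight from 1/u to 1/v matters: partial summation in inductive form.
      have hstep : (∑ p ∈ (Finset.Icc 1 (n + 1)).filter Nat.Prime, 1 / (p : ℝ)) -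
          (∑ p ∈ (Finset.Icc 1 (n + 1)).filter Nat.Prime, Real.log p / p) / v = R - A / v := by
        have hI : Finset.Icc 1 (n + 1) = insert (n + 1) (Finset.Icc 1 n) := by
          ext x; simp only [Finset.mem_Icc, Finset.mem_insert]; omega
        rw [hI, Finset.filter_insert]
        split_ifs with hp
        · rw [Finset.sum_insert (by simp), Finset.sum_insert (by simp), ← hv]
          field_simp
          ring
        · rfl
      rw [hstep]
      have h6 : A * (1 / u - 1 / v) ≤ (u + c) * (1 / u - 1 / v) := by
        refine mul_le_mul_of_nonneg_right hA ?_
        rw [sub_nonneg]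
        exact one_div_le_one_div_of_le hl hl'
      have h7 : (u + c) * (1 / u - 1 / v) = 1 - u / v + c / u - c / v := by
        field_simp
        ring
      have h8 : A * (1 / u - 1 / v) = A / u - A / v := by ring
      linarith
  have h1 := key N hN
  have h2 := sum_log_prime_div_le (n := N) (by omega)
  have hN2 : (2 : ℝ) ≤ N := by exact_mod_cast hN
  have hl : 0 < Real.log N := Real.log_pos (by linarith)
  have h3 : (∑ p ∈ (Finset.Icc 1 N).filter Nat.Prime, Real.log p / p) / Real.log N ≤
      1 + c / Real.log N := by
    rw [div_le_iff₀ hl, add_mul, div_mul_cancel₀ _ hl.ne', one_mul]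
    exact h2
  linarith

/-! ### Assembling the mean value estimate. -/

theorem exists_pow_log_le (c : ℝ) (hc : 0 ≤ c) {k : ℕ} (hk : k ≠ 0) :
    ∃ C : ℝ, 0 ≤ C ∧ ∀ x : ℝ, 1 ≤ x → (2 + c * Real.log x) ^ k ≤ C * x := by
  refine ⟨(2 + c * k) ^ k, by positivity, fun x hx => ?_⟩
  have hk0 : (0 : ℝ) < k := by positivity
  set u := x ^ (1 / (k : ℝ)) with hu
  have hu1 : 1 ≤ u := Real.one_le_rpow hx (by positivity)
  have h1 : Real.log x ≤ u * k := by
    have := Real.log_le_rpow_div (x := x) (ε := 1 / (k : ℝ)) (by linarith) (by positivity)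
    rwa [div_div_eq_mul_div, div_one] at this
  have h2 : u ^ k = x := by
    rw [hu, ← Real.rpow_natCast, ← Real.rpow_mul (by linarith), one_div_mul_cancel hk0.ne',
      Real.rpow_one]
  have h3 : 0 ≤ Real.log x := Real.log_nonneg hx
  calc (2 + c * Real.log x) ^ k ≤ ((2 + c * k) * u) ^ k := by
        refine pow_le_pow_left₀ (by positivity) ?_ k
        nlinarith [mul_le_mul_of_nonneg_left h1 hc]
    _ = _ := by rw [mul_pow, h2]

/-- Either r ≤ 1/L, or Lr ≥ 1 and raising `Lr` to the power `j` only increases it. This converts a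
high-moment bound into a first-moment bound. -/
theorem le_inv_add_pow {L r : ℝ} (hL : 0 < L) (hr : 0 ≤ r) {j : ℕ} (hj : j ≠ 0) :
    r ≤ 1 / L + L ^ j * r ^ j / L := by
  rw [← add_div, le_div_iff₀ hL, ← mul_pow]
  rcases le_total (L * r) 1 with h | h
  · have : 0 ≤ (L * r) ^ j := by positivity
    linarith
  · have := le_self_pow₀ h hj
    linarith

theorem sum_norm_jacobiSum₁_tail_le {j : ℕ} (hj : j ≠ 0) :
    ∃ C : ℝ, 0 ≤ C ∧ ∀ (N : ℕ), 3 ≤ N → ∀ s ⊆ Finset.Icc 1 N, (∀ m ∈ s, Odd m) →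
      (∀ m ∈ s, Squarefree m) → ∀ a : ℕ → ℂ, (∀ n, ‖a n‖ ≤ 1) →
      ∀ y : ℕ, N ^ 3 ≤ (y + 1) ^ j →
      ∑ m ∈ s, ‖jacobiSum₁ a (Finset.Ioc y (N ^ 2)) m‖ ≤ C * (N / Real.log N) := by
  -- The exponent collects all logarithms: 2j from the factor L^j squared, 2^(2j) from the divisor
  -- moment, and one from the bilinear estimate. Together they are absorbed by a spare factor `N`.
  obtain ⟨C₀, hC₀, hC⟩ := exists_pow_log_le (2 * j) (by positivity)
    (k := 2 * j + (2 ^ (j * 2) + 1)) (by positivity)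
  refine ⟨1 + √C₀, by positivity, fun N hN s hs hodd hsq a ha y hy => ?_⟩
  have hN3 : (3 : ℝ) ≤ N := by exact_mod_cast hN
  set L := Real.log N with hL
  have hL0 : 0 < L := Real.log_pos (by linarith)
  set T := ∑ m ∈ s, ‖jacobiSum₁ a (Finset.Ioc y (N ^ 2)) m‖ ^ j with hT
  have hT0 : 0 ≤ T := Finset.sum_nonneg fun _ _ => by positivity
  have hj1 : (1 : ℝ) ≤ j := by exact_mod_cast Nat.one_le_iff_ne_zero.mpr hj
  have h1 := sum_norm_pow_jacobiSum₁_le hs hodd hsq ha hj hy (N ^ 2)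
  have hlog : Real.log (((N ^ 2) ^ j : ℕ) : ℝ) = 2 * j * L := by
    push_cast
    rw [← pow_mul, Real.log_pow]
    push_cast
    ring
  rw [hlog] at h1
  set b := 2 + 2 * j * L with hb
  have hb0 : 0 ≤ b := by positivity
  have h2 : (L ^ j * T) ^ 2 ≤ C₀ * N * N := by
    calc (L ^ j * T) ^ 2 = L ^ (2 * j) * T ^ 2 := by rw [mul_pow, ← pow_mul, mul_comm j]
      _ ≤ b ^ (2 * j) * (b ^ (2 ^ (j * 2)) * (N * b)) := by
          refine mul_le_mul ?_ (h1.trans ?_) (sq_nonneg _) (by positivity)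
          · refine pow_le_pow_left₀ hL0.le ?_ _
            nlinarith
          · refine mul_le_mul_of_nonneg_right ?_ (by positivity)
            refine pow_le_pow_left₀ (by positivity) ?_ _
            linarith
      _ = b ^ (2 * j + (2 ^ (j * 2) + 1)) * N := by rw [pow_add, pow_succ]; ring
      _ ≤ _ := mul_le_mul_of_nonneg_right (hC N (by linarith)) (by positivity)
  have h3 : L ^ j * T ≤ √C₀ * N := by
    refine abs_le_of_sq_le_sq' (b := √C₀ * N) ?_ (by positivity) |>.2
    rw [mul_pow √C₀, Real.sq_sqrt hC₀]
    linarith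
  have hcard : (s.card : ℝ) ≤ N := by
    have := Finset.card_le_card hs
    simp only [Nat.card_Icc, Nat.add_sub_cancel] at this
    exact_mod_cast this
  calc _ ≤ ∑ m ∈ s, (1 / L + L ^ j * ‖jacobiSum₁ a (Finset.Ioc y (N ^ 2)) m‖ ^ j / L) :=
        Finset.sum_le_sum fun m _ => le_inv_add_pow hL0 (norm_nonneg _) hj
    _ = s.card / L + L ^ j * T / L := by
        rw [Finset.sum_add_distrib, Finset.sum_const, nsmul_eq_mul, mul_one_div, ← Finset.sum_div,
          ← Finset.mul_sum]
    _ ≤ N / L + √C₀ * N / L := by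
        refine add_le_add ?_ ?_
        · exact div_le_div_of_nonneg_right hcard hL0.le
        · exact div_le_div_of_nonneg_right h3 hL0.le
    _ = _ := by ring

theorem prod_one_add_div_le {f : ℕ → ℝ} (h0 : ∀ p, p.Prime → 0 ≤ f p)
    (h1 : ∀ p, p.Prime → f p ≤ 1) {y N : ℕ} (hy : y ≤ N) :
    ∏ p ∈ (Finset.Icc 1 y).filter Nat.Prime, (1 + f p / (p - 1)) ≤
      Real.exp 4 * Real.exp (∑ p ∈ (Finset.Icc 1 N).filter Nat.Prime, f p / p) := by
  rw [← Real.exp_add]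
  calc _ ≤ ∏ p ∈ (Finset.Icc 1 y).filter Nat.Prime, Real.exp (2 * (1 / (p : ℝ) ^ 2) + f p / p) := by
        refine Finset.prod_le_prod (fun p hp => ?_) fun p hp => ?_
        · have hp' := (Finset.mem_filter.mp hp).2
          have hp1 : (1 : ℝ) < p := by exact_mod_cast hp'.one_lt
          have := div_nonneg (h0 p hp') (by linarith : (0 : ℝ) ≤ p - 1)
          linarith
        · have hp' := (Finset.mem_filter.mp hp).2
          have hp2 : (2 : ℝ) ≤ p := by exact_mod_cast hp'.two_le
          have e : f p / (p - 1) ≤ 2 * (1 / (p : ℝ) ^ 2) + f p / p := by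
            have hpm : (0 : ℝ) < p - 1 := by linarith
            have e1 : f p / (p - 1) - f p / p = f p * (1 / (p * (p - 1))) := by
              field_simp
              ring
            have e2 : 1 / ((p : ℝ) * (p - 1)) ≤ 2 * (1 / (p : ℝ) ^ 2) := by
              rw [mul_one_div, div_le_div_iff₀ (by positivity) (by positivity)]
              nlinarith
            have e3 : f p * (1 / ((p : ℝ) * (p - 1))) ≤ 1 * (1 / ((p : ℝ) * (p - 1))) :=
              mul_le_mul_of_nonneg_right (h1 p hp') (by positivity)
            linarith
          have := Real.add_one_le_exp (2 * (1 / (p : ℝ) ^ 2) + f p / p)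
          linarith
    _ = Real.exp (∑ p ∈ (Finset.Icc 1 y).filter Nat.Prime,
          (2 * (1 / (p : ℝ) ^ 2) + f p / p)) := (Real.exp_sum _ _).symm
    _ ≤ _ := by
        refine Real.exp_le_exp.mpr ?_
        rw [Finset.sum_add_distrib, ← Finset.mul_sum]
        refine add_le_add ?_ ?_
        · have : ∑ p ∈ (Finset.Icc 1 y).filter Nat.Prime, 1 / (p : ℝ) ^ 2 ≤ 2 :=
            (Finset.sum_le_sum_of_subset_of_nonneg (Finset.filter_subset _ _)
              fun _ _ _ => by positivity).trans (sum_one_div_sq_le y)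
          linarith
        · refine Finset.sum_le_sum_of_subset_of_nonneg
            (Finset.filter_subset_filter _ (Finset.Icc_subset_Icc_right hy)) fun p hp _ => ?_
          exact div_nonneg (h0 p (Finset.mem_filter.mp hp).2) (by positivity)

/-- The mean value estimate: the Selberg sieve handles the initial segment of the series, a
bilinear estimate its tail. -/
theorem exists_sum_multiplicative_mul_norm_le :
    ∃ K : ℝ, 0 ≤ K ∧ ∀ f : ℕ → ℝ, (∀ p, p.Prime → 0 ≤ f p) → (∀ p, p.Prime → f p ≤ 1) →
      ∀ N : ℕ, 3 ≤ N → ∀ s ⊆ Finset.Icc 1 N, (∀ m ∈ s, Odd m) → (∀ m ∈ s, Squarefree m) →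
      (∀ m ∈ s, f m = ∏ p ∈ m.primeFactors, f p) → ∀ a : ℕ → ℂ, (∀ n, ‖a n‖ ≤ 1) →
      ∑ m ∈ s, f m * (‖jacobiSum₁ a (Finset.Icc 1 (N ^ 2)) m‖ + 1) ≤
        K * (N / Real.log N *
          Real.exp (∑ p ∈ (Finset.Icc 1 N).filter Nat.Prime, f p / p)) := by
  -- 36 = 3 · 12: with `y` the integer part of N^(1/12), (y+1)^36 exceeds N³, while the sieve error
  -- 12y⁶ is only O(√N).
  obtain ⟨C, hC0, hC⟩ := sum_norm_jacobiSum₁_tail_le (j := 36) (by norm_num)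
  refine ⟨3 * (96 * Real.exp 4 + 24) + C, by positivity, ?_⟩
  intro f h0 h1 N hN s hs hodd hsq hf a ha
  have hN3 : (3 : ℝ) ≤ N := by exact_mod_cast hN
  set L := Real.log N with hL
  have hL0 : 0 < L := Real.log_pos (by linarith)
  set P := Real.exp (∑ p ∈ (Finset.Icc 1 N).filter Nat.Prime, f p / p) with hP
  have hP1 : 1 ≤ P := by
    refine Real.one_le_exp (Finset.sum_nonneg fun p hp => ?_)
    exact div_nonneg (h0 p (Finset.mem_filter.mp hp).2) (by positivity)
  have hNL : 0 ≤ N / L := by positivity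
  have hNLP : N / L ≤ N / L * P := le_mul_of_one_le_right hNL hP1
  have hfm0 : ∀ m ∈ s, 0 ≤ f m := fun m hm => by
    rw [hf m hm]
    exact Finset.prod_nonneg fun p hp => h0 p (Nat.prime_of_mem_primeFactors hp)
  have hfm1 : ∀ m ∈ s, f m ≤ 1 := fun m hm => by
    rw [hf m hm]
    exact Finset.prod_le_one (fun p hp => h0 p (Nat.prime_of_mem_primeFactors hp))
      fun p hp => h1 p (Nat.prime_of_mem_primeFactors hp)
  set y := Nat.nthRoot 12 N with hy
  have hy1 : y ^ 12 ≤ N := Nat.pow_nthRoot_le (Or.inl (by norm_num))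
  have hy2 : N < (y + 1) ^ 12 := Nat.lt_pow_nthRoot_add_one (by norm_num) N
  have hypos : 1 ≤ y := by
    by_contra h
    have : y = 0 := by omega
    rw [this] at hy2
    norm_num at hy2
    omega
  have hyN : y ≤ N := (Nat.le_self_pow (by norm_num) y).trans hy1
  have hy6 : 12 * (y : ℝ) ^ 6 ≤ 24 * (N / L) := by
    have e1 : (y : ℝ) ^ 6 ≤ √N := by
      refine Real.le_sqrt_of_sq_le ?_
      rw [← pow_mul]
      exact_mod_cast hy1
    have e2 : L ≤ 2 * √N := by
      have hsq0 : 0 < √(N : ℝ) := Real.sqrt_pos.mpr (by linarith)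
      have := Real.log_le_sub_one_of_pos hsq0
      rw [Real.log_sqrt (by linarith)] at this
      linarith
    rw [mul_div_assoc', le_div_iff₀ hL0]
    have e3 := Real.mul_self_sqrt (by linarith : (0 : ℝ) ≤ N)
    have e4 : (y : ℝ) ^ 6 * L ≤ √N * (2 * √N) :=
      mul_le_mul e1 e2 hL0.le (Real.sqrt_nonneg _)
    linarith
  have hlogy : L / 12 ≤ Real.log (y + 1) := by
    have : L ≤ Real.log (((y + 1) ^ 12 : ℕ) : ℝ) :=
      Real.log_le_log (by linarith) (by exact_mod_cast hy2.le)
    push_cast at this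
    rw [Real.log_pow] at this
    push_cast at this
    linarith
  have hsieve : ∀ a : ℕ → ℂ, (∀ n, ‖a n‖ ≤ 1) →
      ∑ m ∈ s, f m * ‖jacobiSum₁ a (Finset.Icc 1 y) m‖ ^ 2 ≤
        (96 * Real.exp 4 + 24) * (N / L * P) := by
    intro a ha
    refine (sum_multiplicative_mul_norm_sq_le h0 h1 hs hf hypos ha).trans ?_
    have e1 : 8 * N / Real.log (y + 1) ≤ 96 * (N / L) := by
      rw [mul_div_assoc', div_le_div_iff₀ (by linarith) hL0]
      nlinarith
    have e2 := prod_one_add_div_le h0 h1 hyN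
    have e3 : 8 * N / Real.log (y + 1) *
        ∏ p ∈ (Finset.Icc 1 y).filter Nat.Prime, (1 + f p / (p - 1)) ≤
        96 * (N / L) * (Real.exp 4 * P) := by
      refine mul_le_mul e1 e2 (Finset.prod_nonneg fun p hp => ?_) (by positivity)
      have hp' := (Finset.mem_filter.mp hp).2
      have hp1 : (1 : ℝ) < p := by exact_mod_cast hp'.one_lt
      have := div_nonneg (h0 p hp') (by linarith : (0 : ℝ) ≤ p - 1)
      linarith
    calc _ ≤ 96 * (N / L) * (Real.exp 4 * P) + 24 * (N / L * P) := by linarith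
      _ = _ := by ring
  -- Coefficients concentrated at n = 1 make the partial sum equal to 1, so the second-moment bound
  -- also controls ∑ f(m).
  have hsum : ∑ m ∈ s, f m ≤ (96 * Real.exp 4 + 24) * (N / L * P) := by
    refine le_trans (le_of_eq ?_) (hsieve (Pi.single 1 1) fun n => ?_)
    · refine Finset.sum_congr rfl fun m hm => ?_
      have : jacobiSum₁ (Pi.single 1 1) (Finset.Icc 1 y) m = 1 := by
        rw [jacobiSum₁, Finset.sum_eq_single 1]
        · simp [oddJacobi_one_left m (hodd m hm)]
        · intro n _ hn
          simp [hn]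
        · intro h
          exact absurd (Finset.mem_Icc.mpr ⟨le_rfl, hypos⟩) h
      rw [this]
      simp
    · by_cases hn : n = 1
      · simp [hn]
      · simp [hn]
  have htail := hC N hN s hs hodd hsq a ha y (by
    calc N ^ 3 ≤ ((y + 1) ^ 12) ^ 3 := Nat.pow_le_pow_left hy2.le 3
      _ = _ := by rw [← pow_mul])
  have hsplit : ∀ m, jacobiSum₁ a (Finset.Icc 1 (N ^ 2)) m =
      jacobiSum₁ a (Finset.Icc 1 y) m + jacobiSum₁ a (Finset.Ioc y (N ^ 2)) m := by
    intro m
    have hyN2 : y ≤ N ^ 2 := hyN.trans (Nat.le_self_pow (by norm_num) N)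
    have e : Finset.Icc 1 (N ^ 2) = Finset.Icc 1 y ∪ Finset.Ioc y (N ^ 2) := by
      ext x
      simp only [Finset.mem_union, Finset.mem_Icc, Finset.mem_Ioc]
      omega
    rw [jacobiSum₁, e, Finset.sum_union]
    · rfl
    · rw [Finset.disjoint_left]
      intro x hx hx'
      simp only [Finset.mem_Icc, Finset.mem_Ioc] at hx hx'
      omega
  calc _ ≤ ∑ m ∈ s, (2 * f m + f m * ‖jacobiSum₁ a (Finset.Icc 1 y) m‖ ^ 2 +
          ‖jacobiSum₁ a (Finset.Ioc y (N ^ 2)) m‖) := by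
        refine Finset.sum_le_sum fun m hm => ?_
        have hn := norm_add_le (jacobiSum₁ a (Finset.Icc 1 y) m)
          (jacobiSum₁ a (Finset.Ioc y (N ^ 2)) m)
        rw [hsplit]
        set u := ‖jacobiSum₁ a (Finset.Icc 1 y) m‖
        set v := ‖jacobiSum₁ a (Finset.Ioc y (N ^ 2)) m‖
        have hv : 0 ≤ v := norm_nonneg _
        have hu : u ≤ 1 + u ^ 2 := by nlinarith [sq_nonneg (u - 1)]
        have e1 := mul_le_mul_of_nonneg_left (hn.trans (add_le_add_left hu v)) (hfm0 m hm)
        have e2 := mul_le_of_le_one_left hv (hfm1 m hm)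
        linarith
    _ = 2 * ∑ m ∈ s, f m + ∑ m ∈ s, f m * ‖jacobiSum₁ a (Finset.Icc 1 y) m‖ ^ 2 +
          ∑ m ∈ s, ‖jacobiSum₁ a (Finset.Ioc y (N ^ 2)) m‖ := by
        rw [Finset.sum_add_distrib, Finset.sum_add_distrib, Finset.mul_sum]
    _ ≤ 2 * ((96 * Real.exp 4 + 24) * (N / L * P)) + (96 * Real.exp 4 + 24) * (N / L * P) +
          C * (N / L * P) := by
        have := mul_le_mul_of_nonneg_left hNLP hC0
        have := hsieve a ha
        linarith
    _ = _ := by ring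

/-! ### Passage to L(1, ·) and conclusion. -/

theorem norm_LOne_le {M : ℕ} (hM : M ≠ 0) {θ : DirichletCharacter ℂ M} (hθ : θ ≠ 1)
    {a : ℕ → ℂ} {m Z : ℕ} (hval : ∀ n : ℕ, θ (n : ZMod M) = a n * oddJacobi n m) {c : ℝ}
    (hc : (M : ℝ) ≤ c * Z) (hc0 : 0 ≤ c) :
    ‖LOne θ‖ ≤ ‖jacobiSum₁ a (Finset.Icc 1 Z) m‖ + c := by
  have h := norm_LOne_sub_sum_le hM hθ Z
  have e : ∑ n ∈ Finset.Ioc 0 Z, θ (n : ZMod M) / n = jacobiSum₁ a (Finset.Icc 1 Z) m := by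
    rw [jacobiSum₁]
    refine Finset.sum_congr (by ext x; simp only [Finset.mem_Ioc, Finset.mem_Icc]; omega)
      fun n _ => ?_
    rw [hval]
    ring
  rw [e] at h
  have h2 : (M : ℝ) / (Z + 1) ≤ c := by
    rw [div_le_iff₀ (by positivity)]
    linarith
  have := norm_le_norm_add_norm_sub' (LOne θ) (jacobiSum₁ a (Finset.Icc 1 Z) m)
  linarith

theorem odd_squarefree_of_squarefree_two_mul {k : ℕ} (h : Squarefree (2 * k)) :
    Odd k ∧ Squarefree k :=
  ⟨Nat.coprime_two_left.mp (Nat.coprime_of_squarefree_mul h), h.of_mul_right⟩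

theorem not_isSquare_of_squarefree {k : ℕ} (hk : Squarefree k) (h1 : k ≠ 1) : ¬ IsSquare k := by
  rintro ⟨b, rfl⟩
  have := Nat.isUnit_iff.mp (hk b dvd_rfl)
  exact h1 (by rw [this])

/-- The factor 2 pays for replacing log ⌊X⌋ by log X, since X ≤ ⌊X⌋² for X ≥ 3. -/
theorem div_log_mul_exp_le {X α C : ℝ} (hX : 3 ≤ X) {S : ℝ}
    (hS : S ≤ α * Real.log (Real.log X) + C) :
    (⌊X⌋₊ : ℝ) / Real.log ⌊X⌋₊ * Real.exp S ≤
      2 * Real.exp C * (X / Real.log X ^ (1 - α)) := by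
  have hN : 3 ≤ ⌊X⌋₊ := Nat.le_floor (by exact_mod_cast hX)
  have hN3 : (3 : ℝ) ≤ ⌊X⌋₊ := by exact_mod_cast hN
  have hNX : (⌊X⌋₊ : ℝ) ≤ X := Nat.floor_le (by linarith)
  have hXN : X < ⌊X⌋₊ + 1 := Nat.lt_floor_add_one X
  have hLX : 0 < Real.log X := Real.log_pos (by linarith)
  have hLN : 0 < Real.log ⌊X⌋₊ := Real.log_pos (by linarith)
  have hlog : Real.log X ≤ 2 * Real.log ⌊X⌋₊ := by
    have h : Real.log X ≤ Real.log ((⌊X⌋₊ : ℝ) ^ 2) :=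
      Real.log_le_log (by linarith) (by nlinarith)
    rwa [Real.log_pow, Nat.cast_ofNat] at h
  have h1 : (⌊X⌋₊ : ℝ) / Real.log ⌊X⌋₊ ≤ 2 * X / Real.log X := by
    rw [div_le_div_iff₀ hLN hLX]
    nlinarith
  have h2 : Real.exp S ≤ Real.log X ^ α * Real.exp C := by
    rw [Real.rpow_def_of_pos hLX, ← Real.exp_add]
    exact Real.exp_le_exp.mpr (by linarith)
  calc _ ≤ 2 * X / Real.log X * (Real.log X ^ α * Real.exp C) :=
        mul_le_mul h1 h2 (Real.exp_nonneg _) (by positivity)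
    _ = _ := by
        rw [Real.rpow_sub hLX, Real.rpow_one]
        field_simp

theorem jacobiBottom_apply_of_one_mod_four {k : ℕ} (hk : k % 4 = 1) (n : ℕ) :
    jacobiBottom k (n : ZMod (4 * k)) =
      (if Odd n then 1 else 0) * oddJacobi n k := by
  have hko : Odd k := Nat.odd_iff.mpr (by omega)
  rw [jacobiBottom_natCast (by omega), oddJacobi, if_pos hko]
  split_ifs with h
  · rw [jacobiSym.quadratic_reciprocity_one_mod_four hk h]
    simp
  · simp

theorem jacobiBottom_apply_of_three_mod_four {k : ℕ} (hk : k % 4 = 3) (n : ℕ) :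
    jacobiBottom k (n : ZMod (4 * k)) =
      (if n % 4 = 1 then 1 else if n % 4 = 3 then -1 else 0) * oddJacobi n k := by
  have hko : Odd k := Nat.odd_iff.mpr (by omega)
  rw [jacobiBottom_natCast (by omega), oddJacobi, if_pos hko]
  split_ifs with h h1 h3 h1 h3
  · rw [jacobiSym.quadratic_reciprocity_one_mod_four' hko h1]
    simp
  · rw [jacobiSym.quadratic_reciprocity_three_mod_four hk h3]
    simp
  · have := Nat.odd_iff.mp h
    omega
  · exact absurd (Nat.odd_iff.mpr (by omega)) h
  · exact absurd (Nat.odd_iff.mpr (by omega)) h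
  · simp

theorem charProd_ne_one_of_exists {q M : ℕ} {χ : DirichletCharacter ℂ q}
    {ψ : DirichletCharacter ℂ M} {n : ℕ} (hn : n ≡ 1 [MOD q]) (hψ : ψ (n : ZMod M) = -1) :
    charProd χ ψ ≠ 1 := by
  refine DirichletCharacter.ne_one_of_apply_natCast (n := n) ?_
  rw [charProd_natCast, hψ, (ZMod.natCast_eq_natCast_iff n 1 q).mpr hn]
  simp

theorem charProd_jacobiTop_ne_one {q k : ℕ} (χ : DirichletCharacter ℂ q) (hk : Odd k)
    (hsq : ¬ IsSquare k) (hq : q.Coprime k) : charProd χ (jacobiTop k) ≠ 1 := by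
  obtain ⟨n, hn, hJ⟩ := exists_modEq_one_jacobiSym_eq_neg_one hk hsq hq
  refine charProd_ne_one_of_exists hn ?_
  rw [jacobiTop_natCast hk.pos.ne', hJ]
  norm_num

/-- Requiring n ≡ 1 modulo 4 as well makes reciprocity sign-free, so (k/n) = (n/k) = -1 while χ(n) =
1. -/
theorem charProd_jacobiBottom_ne_one {q k : ℕ} (χ : DirichletCharacter ℂ q) (hk : Odd k)
    (hsq : ¬ IsSquare k) (hq : q.Coprime k) : charProd χ (jacobiBottom k) ≠ 1 := by
  have h4 : Nat.Coprime 4 k := by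
    have := (Nat.coprime_two_left.mpr hk).pow_left 2
    simpa using this
  obtain ⟨n, hn, hJ⟩ := exists_modEq_one_jacobiSym_eq_neg_one hk hsq
    (Nat.Coprime.mul_left h4 hq)
  have hn4 : n % 4 = 1 := hn.of_mul_right q
  refine charProd_ne_one_of_exists (hn.of_mul_left 4) ?_
  rw [jacobiBottom_natCast hk.pos.ne', if_pos (Nat.odd_iff.mpr (by omega)),
    jacobiSym.quadratic_reciprocity_one_mod_four' hk hn4, hJ]
  norm_num

theorem norm_mul_oddJacobi_le {z : ℂ} (hz : ‖z‖ ≤ 1) (n m : ℕ) : ‖z * oddJacobi n m‖ ≤ 1 := by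
  rw [norm_mul, Complex.norm_real, Real.norm_eq_abs]
  exact mul_le_one₀ hz (abs_nonneg _) (abs_oddJacobi_le _ _)

theorem one_div_card_divisors_eq_prod {m : ℕ} (hm : Squarefree m) :
    1 / (m.divisors.card : ℝ) = ∏ p ∈ m.primeFactors, 1 / (p.divisors.card : ℝ) := by
  rw [Nat.card_divisors hm.ne_zero]
  push_cast
  rw [one_div, ← Finset.prod_inv_distrib]
  refine Finset.prod_congr rfl fun p hp => ?_
  have hpp := Nat.prime_of_mem_primeFactors hp
  have h1 : m.factorization p = 1 := le_antisymm (hm.natFactorization_le_one p)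
    (hpp.factorization_pos_of_dvd hm.ne_zero (Nat.dvd_of_mem_primeFactors hp))
  rw [h1, hpp.divisors, Finset.card_pair hpp.one_lt.ne]
  norm_num

/-- The weight 1/τ takes the value 1/2 at every prime, so ∑ f(p)/p is half of ∑ 1/p, which produces
the exponent 1/2. -/
theorem sum_one_div_card_divisors_mul_LOne_le :
    ∃ K : ℝ, ∀ X : ℝ, 3 ≤ X →
      ‖∑ m ∈ Finset.Ioc 1 ⌊X⌋₊,
          ((ArithmeticFunction.moebius (2 * m) : ℂ) ^ 2 / (m.divisors.card : ℂ)) *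
            LOne (jacobiTop m)‖
        ≤ K * (X / √(Real.log X)) := by
  obtain ⟨K, hK0, hK⟩ := exists_sum_multiplicative_mul_norm_le
  obtain ⟨C, hC⟩ := sum_one_div_prime_le
  refine ⟨K * (2 * Real.exp (C / 2)), fun X hX => ?_⟩
  have hN : 3 ≤ ⌊X⌋₊ := Nat.le_floor (by exact_mod_cast hX)
  set N := ⌊X⌋₊ with hNdef
  set f : ℕ → ℝ := fun m => 1 / (m.divisors.card : ℝ) with hf
  have hfp : ∀ p : ℕ, p.Prime → f p = 1 / 2 := by
    intro p hp
    rw [hf]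
    simp only
    rw [hp.divisors, Finset.card_pair hp.one_lt.ne]
    norm_num
  set s := (Finset.Ioc 1 N).filter fun m => Squarefree (2 * m) with hs
  have hsub : s ⊆ Finset.Icc 1 N := by
    intro m hm
    have := Finset.mem_Ioc.mp (Finset.mem_filter.mp hm).1
    exact Finset.mem_Icc.mpr ⟨by omega, this.2⟩
  have hos : ∀ m ∈ s, Odd m ∧ Squarefree m := fun m hm =>
    odd_squarefree_of_squarefree_two_mul (Finset.mem_filter.mp hm).2
  have hmain := hK f (fun p hp => by rw [hfp p hp]; norm_num)
    (fun p hp => by rw [hfp p hp]; norm_num) N hN s hsub (fun m hm => (hos m hm).1)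
    (fun m hm => (hos m hm).2) (fun m hm => one_div_card_divisors_eq_prod (hos m hm).2)
    (fun _ => 1) (fun _ => by simp)
  have hS : ∑ p ∈ (Finset.Icc 1 N).filter Nat.Prime, f p / p ≤
      1 / 2 * Real.log (Real.log X) + C / 2 := by
    have e : ∀ p ∈ (Finset.Icc 1 N).filter Nat.Prime, f p / p = 1 / 2 * (1 / (p : ℝ)) := by
      intro p hp
      rw [hfp p (Finset.mem_filter.mp hp).2]
      ring
    rw [Finset.sum_congr rfl e, ← Finset.mul_sum]
    have h1 := hC N (by omega)
    have hN3 : (3 : ℝ) ≤ N := by exact_mod_cast hN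
    have h2 : Real.log (Real.log N) ≤ Real.log (Real.log X) :=
      Real.log_le_log (Real.log_pos (by linarith))
        (Real.log_le_log (by linarith) (Nat.floor_le (by linarith)))
    linarith
  have hfin := div_log_mul_exp_le hX hS
  rw [show (1 : ℝ) - 1 / 2 = 1 / 2 by norm_num, ← Real.sqrt_eq_rpow] at hfin
  calc _ ≤ ∑ m ∈ s, f m * (‖jacobiSum₁ (fun _ => 1) (Finset.Icc 1 (N ^ 2)) m‖ + 1) := by
        rw [hs, Finset.sum_filter]
        refine norm_sum_le_of_le _ fun m hm => ?_
        have hm' := Finset.mem_Ioc.mp hm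
        split_ifs with h
        · obtain ⟨ho, hsq⟩ := odd_squarefree_of_squarefree_two_mul h
          have hμ : (ArithmeticFunction.moebius (2 * m) : ℂ) ^ 2 = 1 := by
            exact_mod_cast ArithmeticFunction.moebius_sq_eq_one_of_squarefree h
          rw [hμ, norm_mul, norm_div, norm_one, Complex.norm_natCast]
          refine mul_le_mul_of_nonneg_left ?_ (by positivity)
          have hns := not_isSquare_of_squarefree hsq (by omega)
          have hne : jacobiTop m ≠ 1 := by
            obtain ⟨n, -, hJ⟩ := exists_modEq_one_jacobiSym_eq_neg_one ho hns
              (Nat.coprime_one_left m)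
            refine DirichletCharacter.ne_one_of_apply_natCast (n := n) ?_
            rw [jacobiTop_natCast (by omega), hJ]
            norm_num
          refine norm_LOne_le (by omega) hne (fun n => ?_) ?_ zero_le_one
          · rw [jacobiTop_natCast (by omega), oddJacobi, if_pos ho]
            simp
          · have : m ≤ N ^ 2 := hm'.2.trans (Nat.le_self_pow (by norm_num) N)
            rw [one_mul]
            exact_mod_cast this
        · have hμ : ArithmeticFunction.moebius (2 * m) = 0 := by
            by_contra h'
            exact h (ArithmeticFunction.moebius_ne_zero_iff_squarefree.mp h')
          simp [hμ]
    _ ≤ _ := hmain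
    _ ≤ K * (2 * Real.exp (C / 2) * (X / √(Real.log X))) := mul_le_mul_of_nonneg_left hfin hK0
    _ = _ := by ring

theorem corollary1p3 :
    (∃ K : ℝ, ∀ X : ℝ, 3 ≤ X →
      ‖∑ m ∈ Finset.Ioc 1 ⌊X⌋₊,
          ((ArithmeticFunction.moebius (2 * m) : ℂ) ^ 2 / (m.divisors.card : ℂ)) *
            LOne (jacobiTop m)‖
        ≤ K * (X / √(Real.log X))) ∧
    (∀ q : ℕ, 1 ≤ q → ∀ C : ℝ, ∃ K : ℝ,
      ∀ (χ : DirichletCharacter ℂ q) (f : ArithmeticFunction ℝ) (α : ℝ),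
        0 < α → α ≤ 1 → HasMertensDensity f α C →
      ∀ X : ℝ, 3 ≤ X → ∀ m₁ : ℕ, Odd m₁ → (m₁ : ℝ) ≤ X →
        ‖∑ m ∈ (Finset.Ioc 1 ⌊X⌋₊).filter (fun m => Nat.Coprime (m * m₁) q),
            (ArithmeticFunction.moebius (2 * m * m₁) : ℂ) ^ 2 * (f m : ℂ) *
              LOne (charProd χ (jacobiTop (m * m₁)))‖
          ≤ K * (X / Real.log X ^ (1 - α)) ∧
        ‖∑ m ∈ (Finset.Ioc 1 ⌊X⌋₊).filter (fun m => Nat.Coprime (m * m₁) q),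
            (ArithmeticFunction.moebius (2 * m * m₁) : ℂ) ^ 2 * (f m : ℂ) *
              LOne (charProd χ (jacobiBottom (m * m₁)))‖
          ≤ K * (X / Real.log X ^ (1 - α))) := by
  refine ⟨sum_one_div_card_divisors_mul_LOne_le, fun q hq C => ?_⟩
  obtain ⟨K, hK0, hK⟩ := exists_sum_multiplicative_mul_norm_le
  -- The truncation error is at most 4q, since the modulus is at most 4qN²; the extra factor 2
  -- covers two coefficient sequences in the case of `jacobiBottom`.
  refine ⟨8 * q * K * (2 * Real.exp C), ?_⟩
  intro χ f α _ _ hfd X hX m₁ hm₁ hm₁X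
  have hN : 3 ≤ ⌊X⌋₊ := Nat.le_floor (by exact_mod_cast hX)
  have hm₁N : m₁ ≤ ⌊X⌋₊ := Nat.le_floor hm₁X
  have hmert := hfd.mertens X (by linarith)
  set N := ⌊X⌋₊ with hNdef
  have hq1 : (1 : ℝ) ≤ q := by exact_mod_cast hq
  set s := (Finset.Ioc 1 N).filter fun m => Nat.Coprime (m * m₁) q ∧ Squarefree (2 * (m * m₁))
    with hs
  have hsub : s ⊆ Finset.Icc 1 N := by
    intro m hm
    have := Finset.mem_Ioc.mp (Finset.mem_filter.mp hm).1
    exact Finset.mem_Icc.mpr ⟨by omega, this.2⟩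
  have hk : ∀ m ∈ s, 1 < m ∧ m ≤ N ∧ Odd (m * m₁) ∧ ¬ IsSquare (m * m₁) ∧
      q.Coprime (m * m₁) ∧ Squarefree m ∧ Squarefree (2 * (m * m₁)) := by
    intro m hm
    obtain ⟨h1, h2, h3⟩ := Finset.mem_filter.mp hm
    obtain ⟨h4, h5⟩ := Finset.mem_Ioc.mp h1
    obtain ⟨h6, h7⟩ := odd_squarefree_of_squarefree_two_mul h3
    -- Here m > 1 is essential: it keeps the squarefree number m·m₁ different from 1, hence a
    -- nonsquare.
    refine ⟨h4, h5, h6, not_isSquare_of_squarefree h7 fun h => ?_, h2.symm, h7.of_mul_left, h3⟩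
    have := Nat.eq_one_of_mul_eq_one_right h
    omega
  have hfs : ∀ m ∈ s, f m = ∏ p ∈ m.primeFactors, f p := by
    intro m hm
    have hsq := (hk m hm).2.2.2.2.2.1
    conv_lhs => rw [← Nat.prod_primeFactors_of_squarefree hsq]
    exact hfd.multiplicative.map_prod_of_prime _ fun p hp => Nat.prime_of_mem_primeFactors hp
  have hf0 : ∀ m ∈ s, 0 ≤ f m := by
    intro m hm
    rw [hfs m hm]
    exact Finset.prod_nonneg fun p hp => hfd.nonneg p (Nat.prime_of_mem_primeFactors hp)
  set E := (N : ℝ) / Real.log N *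
    Real.exp (∑ p ∈ (Finset.Icc 1 N).filter Nat.Prime, f p / p) with hE
  have hE0 : 0 ≤ E := by positivity
  have hfin : E ≤ 2 * Real.exp C * (X / Real.log X ^ (1 - α)) :=
    div_log_mul_exp_le hX (by linarith [(abs_le.mp hmert).2])
  have hmain : ∀ a : ℕ → ℂ, (∀ n, ‖a n‖ ≤ 1) →
      ∑ m ∈ s, f m * (‖jacobiSum₁ a (Finset.Icc 1 (N ^ 2)) m‖ + 4 * q) ≤ 4 * q * (K * E) := by
    intro a ha
    refine le_trans ?_ (mul_le_mul_of_nonneg_left (hK f hfd.nonneg hfd.le_one N hN s hsub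
      (fun m hm => (Nat.odd_mul.mp (hk m hm).2.2.1).1) (fun m hm => (hk m hm).2.2.2.2.2.1)
      hfs a ha) (by positivity))
    rw [Finset.mul_sum]
    refine Finset.sum_le_sum fun m hm => ?_
    have h1 := mul_nonneg (hf0 m hm) (norm_nonneg (jacobiSum₁ a (Finset.Icc 1 (N ^ 2)) m))
    nlinarith
  have hreduce : ∀ (L : ℕ → ℂ) (B : ℝ), ∑ m ∈ s, f m * ‖L m‖ ≤ B →
      ‖∑ m ∈ (Finset.Ioc 1 N).filter (fun m => Nat.Coprime (m * m₁) q),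
        (ArithmeticFunction.moebius (2 * m * m₁) : ℂ) ^ 2 * (f m : ℂ) * L m‖ ≤ B := by
    intro L B hB
    refine le_trans ?_ hB
    rw [hs, ← Finset.filter_filter, Finset.sum_filter (p := fun m => Squarefree (2 * (m * m₁)))]
    refine norm_sum_le_of_le _ fun m hm => ?_
    rw [mul_assoc 2 m m₁]
    split_ifs with h
    · have hμ : (ArithmeticFunction.moebius (2 * (m * m₁)) : ℂ) ^ 2 = 1 := by
        exact_mod_cast ArithmeticFunction.moebius_sq_eq_one_of_squarefree h
      have hms : m ∈ s := Finset.mem_filter.mpr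
        ⟨(Finset.mem_filter.mp hm).1, (Finset.mem_filter.mp hm).2, h⟩
      rw [hμ, one_mul, norm_mul, Complex.norm_real, Real.norm_of_nonneg (hf0 m hms)]
    · have hμ : ArithmeticFunction.moebius (2 * (m * m₁)) = 0 := by
        by_contra h'
        exact h (ArithmeticFunction.moebius_ne_zero_iff_squarefree.mp h')
      simp [hμ]
  have hmod : ∀ m ∈ s, ((m * m₁ : ℕ) : ℝ) ≤ ((N ^ 2 : ℕ) : ℝ) := by
    intro m hm
    have : m * m₁ ≤ N ^ 2 := by
      rw [sq]
      exact Nat.mul_le_mul (hk m hm).2.1 hm₁N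
    exact_mod_cast this
  have hχ : ∀ n : ℕ, ‖χ (n : ZMod q)‖ ≤ 1 := fun n => χ.norm_le_one _
  have hq0 : q ≠ 0 := by omega
  have hfinal : 8 * q * (K * E) ≤
      8 * q * K * (2 * Real.exp C) * (X / Real.log X ^ (1 - α)) := by
    have := mul_le_mul_of_nonneg_left hfin (by positivity : 0 ≤ 8 * q * K)
    linarith
  constructor
  · refine hreduce _ _ ?_
    set a : ℕ → ℂ := fun n => χ (n : ZMod q) * oddJacobi n m₁ with ha
    have ha1 : ∀ n, ‖a n‖ ≤ 1 := fun n => norm_mul_oddJacobi_le (hχ n) _ _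
    have hKE : 0 ≤ q * (K * E) := by positivity
    refine le_trans ?_ ((hmain a ha1).trans ((by linarith : _ ≤ 8 * q * (K * E)).trans hfinal))
    refine Finset.sum_le_sum fun m hm => mul_le_mul_of_nonneg_left ?_ (hf0 m hm)
    obtain ⟨h1, h2, h3, h4, h5, h6, h7⟩ := hk m hm
    have hk0 : m * m₁ ≠ 0 := h3.pos.ne'
    refine norm_LOne_le (by positivity) (charProd_jacobiTop_ne_one χ h3 h4 h5) (fun n => ?_) ?_
      (by positivity)
    · rw [charProd_natCast, jacobiTop_natCast hk0, ha]
      have e := oddJacobi_mul_right n m m₁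
      rw [oddJacobi, if_pos h3] at e
      have e' : ((jacobiSym (n : ℤ) (m * m₁) : ℤ) : ℂ) = oddJacobi n m * oddJacobi n m₁ := by
        exact_mod_cast congrArg (fun z : ℝ => (z : ℂ)) e
      rw [e']
      ring
    · have := hmod m hm
      rw [Nat.cast_mul]
      nlinarith
  · refine hreduce _ _ ?_
    set a : ℕ → ℂ := fun n => χ (n : ZMod q) * (if Odd n then 1 else 0) * oddJacobi n m₁ with ha
    set b : ℕ → ℂ := fun n => χ (n : ZMod q) *
      (if n % 4 = 1 then 1 else if n % 4 = 3 then -1 else 0) * oddJacobi n m₁ with hb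
    have ha1 : ∀ n, ‖a n‖ ≤ 1 := fun n => norm_mul_oddJacobi_le (by
      rw [norm_mul]
      refine mul_le_one₀ (hχ n) (norm_nonneg _) ?_
      split_ifs <;> simp) _ _
    have hb1 : ∀ n, ‖b n‖ ≤ 1 := fun n => norm_mul_oddJacobi_le (by
      rw [norm_mul]
      refine mul_le_one₀ (hχ n) (norm_nonneg _) ?_
      split_ifs <;> simp) _ _
    -- Reciprocity selects `a` or `b` according to m·m₁ mod 4. Adding the two bounds avoids
    -- splitting the sum over `m`.
    refine le_trans ?_ (((add_le_add (hmain a ha1) (hmain b hb1)).trans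
      (by linarith : _ ≤ 8 * q * (K * E))).trans hfinal)
    rw [← Finset.sum_add_distrib]
    refine Finset.sum_le_sum fun m hm => ?_
    rw [← mul_add]
    refine mul_le_mul_of_nonneg_left ?_ (hf0 m hm)
    obtain ⟨h1, h2, h3, h4, h5, h6, h7⟩ := hk m hm
    have hk0 : m * m₁ ≠ 0 := h3.pos.ne'
    have hne := charProd_jacobiBottom_ne_one χ h3 h4 h5
    have hM : ((q * (4 * (m * m₁)) : ℕ) : ℝ) ≤ 4 * q * ((N ^ 2 : ℕ) : ℝ) := by
      have := hmod m hm
      push_cast at this ⊢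
      nlinarith
    have e' : ∀ n, (oddJacobi n (m * m₁) : ℂ) = oddJacobi n m * oddJacobi n m₁ := by
      intro n
      rw [oddJacobi_mul_right]
      push_cast
      rfl
    rcases Nat.odd_mod_four_iff.mp (Nat.odd_iff.mp h3) with h8 | h8
    · refine (norm_LOne_le (a := a) (m := m) (Z := N ^ 2) (c := 4 * q) (by positivity) hne
        (fun n => ?_) hM (by positivity)).trans (le_add_of_nonneg_right (by positivity))
      rw [charProd_natCast, jacobiBottom_apply_of_one_mod_four h8, e', ha]
      ring
    · refine (norm_LOne_le (a := b) (m := m) (Z := N ^ 2) (c := 4 * q) (by positivity) hne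
        (fun n => ?_) hM (by positivity)).trans (le_add_of_nonneg_left (by positivity))
      rw [charProd_natCast, jacobiBottom_apply_of_three_mod_four h8, e', hb]
      ring
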